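/- Let $N\ge 1$ and let $K:\mathbb R^N\to[0,+\infty)$ satisfy $K(x)=K(-x)$ for all $x$ and $\min(|x|,1)\,K(x)\in L^1(\mathbb R^N)$. For a nonnegative measurable kernel $k$ and a measurable set $E\subseteq\mathbb R^N$ let \[\mathrm{Per}_k(E)=\int_E\int_{\mathbb R^N\setminus E}k(x-y)\,dy\,dx\in[0,+\infty].\] For $0\le m<\infty$ let $B_m(x)$ be the open ball with centre $x$ and volume $m$ (empty if $m=0$), and let $B_m=B_m(0)$. Let \[K^\star(x)=\int_0^{+\infty}\chi_{B_{|\{K>t\}|}}(x)\,dt\] be the symmetric decreasing rearrangement of $K$. Then: 1. For every measurable set $E\subseteq\mathbb R^N$ with $|E|<\infty$, \[\mathrm{Per}_K(E)\ge \mathrm{Per}_{K^\star}(B_{|E|}).\] 2. If $K$ is radially symmetric and decreasing, that is, if $K(x)$ is a nonincreasing function of $|x|$ for $x\ne 0$, then for every such $E$ \[\mathrm{Per}_K(E)\ge \mathrm{Per}_K(B_{|E|}).\] 3. If $K$ is radially symmetric and strictly decreasing, that is, if $K(x)$ is a strictly decreasing function of $|x|$ for $x\neq 0$, then for every such $E$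 equality $\mathrm{Per}_K(E)=\mathrm{Per}_K(B_{|E|})$ holds if and only if $E$ is, up to a Lebesgue-null set, a translate of $B_{|E|}$, i.e. $|E\,\triangle\,B_{|E|}(x)|=0$ for some $x\in\mathbb R^N$. -/

import Mathlib

open MeasureTheory Set
open scoped ENNReal NNReal

/-- The ball `B_m(x)` of `ℝ^N` with centre `x` and volume `m`: the open ball of radius
`(m / ω_N) ^ (1 / N)`, where `ω_N` is the volume of the unit ball (for `m < ∞`).
The ball `B_m` is `volBall 0 m`. -/
noncomputable def volBall {N : ℕ} (x : EuclideanSpace ℝ (Fin N)) (m : ℝ≥0∞) :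
    Set (EuclideanSpace ℝ (Fin N)) :=
  Metric.ball x
    (((m / volume (Metric.ball (0 : EuclideanSpace ℝ (Fin N)) 1)) ^ (1 / (N : ℝ))).toReal)

/-- The symmetric rearrangement of a set of finite volume: the ball centred at `0` with the same
volume. -/
noncomputable def symmRearr {N : ℕ} (A : Set (EuclideanSpace ℝ (Fin N))) :
    Set (EuclideanSpace ℝ (Fin N)) :=
  volBall 0 (volume A)

/-- The symmetric decreasing rearrangement `h⋆(x) = ∫₀^∞ χ_{{h > t}⋆}(x) dt` of a nonnegative
function all of whose level sets `{h > t}`, `t > 0`, have finite volume. It may be `∞` at `0`. -/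
noncomputable def symmDecrRearr {N : ℕ} (h : EuclideanSpace ℝ (Fin N) → ℝ≥0∞)
    (x : EuclideanSpace ℝ (Fin N)) : ℝ≥0∞ :=
  ∫⁻ t in Ioi (0 : ℝ), (symmRearr {y | ENNReal.ofReal t < h y}).indicator 1 x

/-- The nonlocal perimeter `Per_k(E) = ∫_E ∫_{ℝ^N ∖ E} k(x - y) dy dx`, with values in `[0, ∞]`. -/
noncomputable def nonlocalPer {N : ℕ} (k : EuclideanSpace ℝ (Fin N) → ℝ≥0∞)
    (E : Set (EuclideanSpace ℝ (Fin N))) : ℝ≥0∞ :=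
  ∫⁻ x in E, ∫⁻ y in Eᶜ, k (x - y)

/-- `K` is radially symmetric and decreasing in the wide sense: `K x` is a nonincreasing function
of `|x| > 0`. The value at the origin is left free, so that singular kernels such as
`|x| ^ (-(N + s))` are covered. -/
def RadiallyDecreasing {N : ℕ} (K : EuclideanSpace ℝ (Fin N) → ℝ≥0) : Prop :=
  ∃ φ : ℝ → ℝ≥0, AntitoneOn φ (Ioi 0) ∧ ∀ x, x ≠ 0 → K x = φ ‖x‖

/-- `K` is radially symmetric and strictly decreasing: `K x` is a strictly decreasing function of
`|x| > 0`. -/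
def RadiallyStrictlyDecreasing {N : ℕ} (K : EuclideanSpace ℝ (Fin N) → ℝ≥0) : Prop :=
  ∃ φ : ℝ → ℝ≥0, StrictAntiOn φ (Ioi 0) ∧ ∀ x, x ≠ 0 → K x = φ ‖x‖

/-!
The inequalities rest on Riesz' rearrangement inequality for three sets of finite measure. By the
layer-cake formula `Per_K(E)` is the integral over `t > 0` of `Per_G(E)` with `G = {K > t}`, and
`Per_G(E) = |E| |G| - ∫∫ χ_G(x - y) χ_E(x) χ_E(y)` (`nonlocalPer_indicator_add_rieszForm`), so that
the claim for each superlevel set is Riesz' inequality (`rieszForm_le_symmRearr`). A radially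
decreasing kernel has balls as superlevel sets, up to null sets, hence it has the same perimeters as
its rearrangement.

Riesz' inequality on the line follows from a cut of both sets at a quantile
(`rieszForm_real_le`), the resulting bound being attained by centred intervals for the best choice
of the cut. Fubini's theorem shows that Steiner symmetrization in any direction does not decrease
the trilinear form (`rieszForm_le_steiner`). No compactness is needed to reach the balls: if `A` is
a bounded set and `B` is the centred ball of the same volume, then averaging over translations
gives a vector `ξ` that carries a part of `B \ A` of measure at least a constant times `|B \ A| ^ 2`
into `A \ B`, and symmetrization in the direction of `ξ` lowers `|B \ A|` by at least this measure
(`volume_sdiff_steiner_add_le`, `exists_symmetrization_close`). The gains of three sets are summed,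
so the same direction serves all of them.

For the equality case, balls have finite perimeter (`nonlocalPer_ball_ne_top`), so a set `E` with
equality is a minimizer of finite perimeter. Polarization in a hyperplane strictly decreases the
perimeter unless, up to null sets, it turns `E` into `E` itself or into its reflection
(`lintegral_crossInteraction_polarize_lt`). A minimizer is therefore symmetric in every hyperplane
that bisects it; bisecting in the coordinate directions and translating makes it symmetric about
the origin. Then, for every hyperplane, the side containing the origin has at least half of the
mass of `E`, and polarization towards this side changes nothing. If `E` differed from the centred
ball `B`, the reflection exchanging a density point of `B \ E` with one of `E \ B` would contradict
this (`exists_hyperplaneReflection_inter`, `ae_eq_volBall_of_symmetric_minimizer`).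
-/

/-! ### Riesz inequality on the line -/

/-- The trilinear form `∫∫ χ_A(x) χ_B(y) χ_C(x + y) dx dy` of three sets, written as the measure
of a subset of the product space. -/
noncomputable def rieszForm {G : Type*} [MeasureSpace G] [Add G] (A B C : Set G) : ℝ≥0∞ :=
  (volume : Measure (G × G)) {p | p.1 ∈ A ∧ p.2 ∈ B ∧ p.1 + p.2 ∈ C}

/-- Quantiles: the distribution function of a finite atomless measure takes every value strictly
between `0` and the total mass. -/
theorem exists_measure_Iic_eq (μ : Measure ℝ) [IsFiniteMeasure μ] [NullSingletonClass μ] {t : ℝ≥0∞}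
    (h0 : 0 < t) (h1 : t < μ univ) : ∃ α, μ (Iic α) = t := by
  have hbot : ∃ a, μ (Iic a) < t := by
    have h : Filter.Tendsto (fun x : ℝ => μ (Iic x)) Filter.atBot (nhds 0) := by
      have := tendsto_measure_iInter_atBot (μ := μ) (s := fun x : ℝ => Iic x)
        (fun _ => measurableSet_Iic.nullMeasurableSet) monotone_Iic ⟨0, measure_ne_top _ _⟩
      have he : (⋂ x : ℝ, Iic x) = ∅ := iInter_Iic_eq_empty_iff.2 (by simp)
      rwa [he, measure_empty] at this
    exact ((tendsto_order.1 h).2 t h0).exists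
  have htop : ∃ a, t < μ (Iic a) :=
    ((tendsto_order.1 (tendsto_measure_Iic_atTop μ)).1 t h1).exists
  obtain ⟨a, ha⟩ := hbot
  obtain ⟨b, hb⟩ := htop
  set S : Set ℝ := {x | μ (Iic x) ≤ t} with hS
  have hSa : a ∈ S := ha.le
  have hSb : BddAbove S := ⟨b, fun x hx => by
    by_contra! hlt
    exact absurd (hb.trans_le (measure_mono (Iic_subset_Iic.2 hlt.le))) (not_lt.2 hx)⟩
  refine ⟨sSup S, le_antisymm ?_ ?_⟩
  · rw [← measure_congr (Iio_ae_eq_Iic (μ := μ) (a := sSup S))]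
    obtain ⟨u, hu, hult, hut⟩ := exists_seq_strictMono_tendsto (sSup S)
    have hU : Iio (sSup S) = ⋃ n, Iic (u n) :=
      (iUnion_Iic_eq_Iio_of_lt_of_tendsto hult hut).symm
    rw [hU]
    refine le_of_tendsto' (tendsto_measure_iUnion_atTop
      (fun i j hij => Iic_subset_Iic.2 (hu.monotone hij))) fun n => ?_
    obtain ⟨x, hx, hux⟩ := exists_lt_of_lt_csSup ⟨a, hSa⟩ (hult n)
    exact (measure_mono (Iic_subset_Iic.2 hux.le)).trans hx
  · obtain ⟨u, hu, hult, hut⟩ := exists_seq_strictAnti_tendsto (sSup S)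
    have hU : Iic (sSup S) = ⋂ n, Iic (u n) := by
      ext x
      simp only [mem_Iic, mem_iInter]
      exact ⟨fun h n => h.trans (hult n).le, fun h => ge_of_tendsto' hut h⟩
    rw [hU]
    refine ge_of_tendsto' (tendsto_measure_iInter_atTop
      (fun _ => measurableSet_Iic.nullMeasurableSet)
      (fun i j hij => Iic_subset_Iic.2 (hu.antitone hij)) ⟨0, measure_ne_top _ _⟩) fun n => ?_
    by_contra! hlt
    exact absurd (le_csSup hSb (show u n ∈ S from hlt.le)) (not_le.2 (hult n))

theorem exists_volume_inter_Iic_eq {A : Set ℝ} (hA : volume A ≠ ∞) {t : ℝ≥0∞}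
    (h0 : 0 < t) (h1 : t < volume A) : ∃ α, volume (A ∩ Iic α) = t := by
  have : IsFiniteMeasure (volume.restrict A) := isFiniteMeasure_restrict.2 hA
  obtain ⟨α, h⟩ := exists_measure_Iic_eq (volume.restrict A) h0 (by simpa using h1)
  exact ⟨α, by rwa [Measure.restrict_apply measurableSet_Iic, inter_comm] at h⟩

theorem exists_volume_inter_Ici_eq {A : Set ℝ} (hA : volume A ≠ ∞) {t : ℝ≥0∞}
    (h0 : 0 < t) (h1 : t < volume A) : ∃ α, volume (A ∩ Ici α) = t := by
  have hn : ∀ S : Set ℝ, volume (-S) = volume S := fun S => Measure.measure_neg _ S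
  obtain ⟨α, h⟩ := exists_volume_inter_Iic_eq (A := -A) (by rwa [hn]) h0 (by rwa [hn])
  refine ⟨-α, ?_⟩
  rw [← hn] at h
  simpa using h

theorem measurableSet_rieszForm {G : Type*} [MeasurableSpace G] [Add G] [MeasurableAdd₂ G]
    {A B C : Set G} (hA : MeasurableSet A) (hB : MeasurableSet B) (hC : MeasurableSet C) :
    MeasurableSet {p : G × G | p.1 ∈ A ∧ p.2 ∈ B ∧ p.1 + p.2 ∈ C} :=
  (measurable_fst hA).inter ((measurable_snd hB).inter ((measurable_fst.add measurable_snd) hC))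

/-- Slicing along the lines `x + y = const`. -/
theorem volume_prod_eq_lintegral_add {S : Set (ℝ × ℝ)} (hS : MeasurableSet S) :
    volume S = ∫⁻ x, volume {y | (y, x - y) ∈ S} := by
  have h := measurePreserving_prod_neg_add (G := ℝ) volume volume
  rw [← Measure.volume_eq_prod] at h
  rw [← h.measure_preimage hS.nullMeasurableSet, Measure.volume_eq_prod,
    Measure.prod_apply_symm (h.measurable hS)]
  refine lintegral_congr fun x => congrArg _ ?_
  ext y
  simp [sub_eq_neg_add]

/-- The one-dimensional upper bound behind Riesz' inequality. Cut off the lowest part of mass `t`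
of `A` and the highest part of mass `t` of `B`: the pairs that survive number at most
`(|A| - t) (|B| - t)`, and on each line `y + z = x` the discarded pairs form a set of length at
most `t`, because they are described by a half-line in `y`. -/
theorem rieszForm_real_le {A B C : Set ℝ} (hA : MeasurableSet A) (hB : MeasurableSet B)
    (hC : MeasurableSet C) (hAf : volume A ≠ ∞) (hBf : volume B ≠ ∞) {t : ℝ≥0∞} (h0 : 0 < t)
    (htA : t < volume A) (htB : t < volume B) :
    rieszForm A B C ≤ t * volume C + (volume A - t) * (volume B - t) := by
  obtain ⟨α, hα⟩ := exists_volume_inter_Iic_eq hAf h0 htA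
  obtain ⟨β, hβ⟩ := exists_volume_inter_Ici_eq hBf h0 htB
  have ht : t ≠ ∞ := (htA.trans_le le_top).ne
  set S := {p : ℝ × ℝ | p.1 ∈ A ∧ p.2 ∈ B ∧ p.1 + p.2 ∈ C} with hS
  have hSm : MeasurableSet S := measurableSet_rieszForm hA hB hC
  set S₁ := S ∩ {p | p.1 ≤ α ∨ β ≤ p.2} with hS₁
  have hS₁m : MeasurableSet S₁ := hSm.inter
    ((measurableSet_le measurable_fst measurable_const).union
      (measurableSet_le measurable_const measurable_snd))
  have hsub : S ⊆ S₁ ∪ (A \ Iic α) ×ˢ (B \ Ici β) := by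
    rintro ⟨y, z⟩ h
    by_cases h' : y ≤ α ∨ β ≤ z
    · exact Or.inl ⟨h, h'⟩
    · push Not at h'
      exact Or.inr ⟨⟨h.1, by simpa using h'.1⟩, ⟨h.2.1, by simpa using h'.2⟩⟩
  have h1 : volume S₁ ≤ t * volume C := by
    rw [volume_prod_eq_lintegral_add hS₁m, ← setLIntegral_const, ← lintegral_indicator hC]
    refine lintegral_mono fun x => ?_
    by_cases hx : x ∈ C
    · rw [indicator_of_mem hx]
      rcases le_total α (x - β) with h | h
      · calc volume {y | (y, x - y) ∈ S₁} ≤ volume ((fun y => x - y) ⁻¹' (B ∩ Ici β)) := by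
              refine measure_mono ?_
              rintro y ⟨⟨-, hyB, -⟩, hy⟩
              refine ⟨hyB, ?_⟩
              simp only [mem_Ici]
              rcases hy with hy | hy
              · simp only at hy; linarith
              · exact hy
          _ = t := by
              rw [(Measure.measurePreserving_sub_left volume x).measure_preimage
                (hB.inter measurableSet_Ici).nullMeasurableSet, hβ]
      · calc volume {y | (y, x - y) ∈ S₁} ≤ volume (A ∩ Iic α) := by
              refine measure_mono ?_
              rintro y ⟨⟨hyA, -, -⟩, hy⟩
              refine ⟨hyA, ?_⟩
              simp only [mem_Iic]
              rcases hy with hy | hy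
              · exact hy
              · simp only at hy; linarith
          _ = t := hα
    · rw [indicator_of_notMem hx]
      refine le_of_eq (measure_mono_null (t := ∅) ?_ measure_empty)
      rintro y ⟨⟨-, -, hy⟩, -⟩
      exact hx (by simpa using hy)
  have h2 : volume ((A \ Iic α) ×ˢ (B \ Ici β)) = (volume A - t) * (volume B - t) := by
    have eA : volume (A \ Iic α) = volume A - t := ENNReal.eq_sub_of_add_eq ht (by
      rw [← hα]; exact measure_sdiff_add_inter A measurableSet_Iic)
    have eB : volume (B \ Ici β) = volume B - t := ENNReal.eq_sub_of_add_eq ht (by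
      rw [← hβ]; exact measure_sdiff_add_inter B measurableSet_Ici)
    rw [Measure.volume_eq_prod, Measure.prod_prod, eA, eB]
  calc rieszForm A B C ≤ volume S₁ + volume ((A \ Iic α) ×ˢ (B \ Ici β)) :=
        (measure_mono hsub).trans (measure_union_le _ _)
    _ ≤ _ := by rw [h2]; gcongr

/-- The open interval of length `m` centred at the origin. -/
def centeredInterval (m : ℝ≥0∞) : Set ℝ := {s | ENNReal.ofReal (2 * |s|) < m}

theorem mem_centeredInterval_ofReal {m s : ℝ} :
    s ∈ centeredInterval (ENNReal.ofReal m) ↔ |s| < m / 2 := by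
  rw [centeredInterval, mem_ofPred_eq, ENNReal.ofReal_lt_ofReal_iff']
  constructor
  · rintro ⟨h, -⟩; linarith
  · intro h
    have := abs_nonneg s
    exact ⟨by linarith, by linarith⟩

theorem measurableSet_centeredInterval (m : ℝ≥0∞) : MeasurableSet (centeredInterval m) :=
  measurableSet_lt (by fun_prop) measurable_const

theorem centeredInterval_mono {a b : ℝ≥0∞} (h : a ≤ b) :
    centeredInterval a ⊆ centeredInterval b := fun _ hs => lt_of_lt_of_le hs h

theorem volume_centeredInterval (m : ℝ≥0∞) : volume (centeredInterval m) = m := by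
  rcases eq_or_ne m ∞ with rfl | hm
  · have : centeredInterval ∞ = univ := by
      ext s
      exact iff_of_true ENNReal.ofReal_lt_top trivial
    simp [this]
  · lift m to ℝ≥0 using hm
    have : centeredInterval (m : ℝ≥0∞) = Ioo (-((m : ℝ) / 2)) ((m : ℝ) / 2) := by
      ext s
      rw [← ENNReal.ofReal_coe_nnreal, mem_centeredInterval_ofReal, abs_lt, mem_Ioo]
    rw [this, Real.volume_Ioo]
    ring_nf
    exact ENNReal.ofReal_coe_nnreal

theorem rieszForm_le_mul {G : Type*} [MeasureSpace G] [SFinite (volume : Measure G)] [Add G]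
    (A B C : Set G) : rieszForm A B C ≤ volume A * volume B := by
  rw [← Measure.prod_prod, ← Measure.volume_eq_prod]
  exact measure_mono fun p hp => ⟨hp.1, hp.2.1⟩

/-- `{(x, y) | x ∈ A, x + y ∈ C}` has measure `|A| |C|`. -/
theorem volume_fst_mem_add_mem {G : Type*} [MeasureSpace G] [AddGroup G] [MeasurableAdd₂ G]
    [SFinite (volume : Measure G)] [(volume : Measure G).IsAddLeftInvariant]
    {A C : Set G} (hA : MeasurableSet A) (hC : MeasurableSet C) :
    (volume : Measure (G × G)) {p | p.1 ∈ A ∧ p.1 + p.2 ∈ C} = volume A * volume C := by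
  have h := measurePreserving_prod_add (G := G) volume volume
  rw [← Measure.prod_prod, Measure.volume_eq_prod,
    ← h.measure_preimage (hA.prod hC).nullMeasurableSet]
  rfl

theorem volume_snd_mem_add_mem {G : Type*} [MeasureSpace G] [AddGroup G] [MeasurableAdd₂ G]
    [SFinite (volume : Measure G)] [(volume : Measure G).IsAddRightInvariant]
    {B C : Set G} (hB : MeasurableSet B) (hC : MeasurableSet C) :
    (volume : Measure (G × G)) {p | p.2 ∈ B ∧ p.1 + p.2 ∈ C} = volume B * volume C := by
  have h := measurePreserving_add_prod (G := G) volume volume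
  rw [mul_comm, ← Measure.prod_prod, Measure.volume_eq_prod,
    ← h.measure_preimage (hC.prod hB).nullMeasurableSet]
  congr 1
  ext p
  exact and_comm

theorem rieszForm_le_mul_left {G : Type*} [MeasureSpace G] [AddGroup G] [MeasurableAdd₂ G]
    [SFinite (volume : Measure G)] [(volume : Measure G).IsAddLeftInvariant]
    {A B C : Set G} (hA : MeasurableSet A) (hC : MeasurableSet C) :
    rieszForm A B C ≤ volume A * volume C := by
  rw [← volume_fst_mem_add_mem hA hC]
  exact measure_mono fun p hp => ⟨hp.1, hp.2.2⟩

theorem rieszForm_le_mul_right {G : Type*} [MeasureSpace G] [AddGroup G] [MeasurableAdd₂ G]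
    [SFinite (volume : Measure G)] [(volume : Measure G).IsAddRightInvariant]
    {A B C : Set G} (hB : MeasurableSet B) (hC : MeasurableSet C) :
    rieszForm A B C ≤ volume B * volume C := by
  rw [← volume_snd_mem_add_mem hB hC]
  exact measure_mono fun p hp => ⟨hp.2.1, hp.2.2⟩

/-- The right triangle with legs `t` cut off from the corner `(p, q)` of a quadrant. -/
theorem volume_corner_le (p q t : ℝ) (ht : 0 ≤ t) :
    volume {x : ℝ × ℝ | x.1 < p ∧ x.2 < q ∧ p + q - t ≤ x.1 + x.2} ≤
      ENNReal.ofReal (t ^ 2 / 2) := by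
  have hm : MeasurableSet {x : ℝ × ℝ | x.1 < p ∧ x.2 < q ∧ p + q - t ≤ x.1 + x.2} :=
    (measurableSet_lt measurable_fst measurable_const).inter
      ((measurableSet_lt measurable_snd measurable_const).inter
        (measurableSet_le measurable_const (measurable_fst.add measurable_snd)))
  rw [Measure.volume_eq_prod, Measure.prod_apply hm]
  calc _ ≤ ∫⁻ s, (Ioc (p - t) p).indicator (fun s => ENNReal.ofReal (s - (p - t))) s := by
        refine lintegral_mono fun s => ?_
        by_cases hs : s ∈ Ioc (p - t) p
        · rw [indicator_of_mem hs]
          calc _ ≤ volume (Ico (p + q - t - s) q) := measure_mono fun y hy => by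
                obtain ⟨-, h2, h3⟩ := hy
                simp only at h2 h3
                exact ⟨by linarith, h2⟩
            _ = _ := by rw [Real.volume_Ico]; congr 1; ring
        · rw [indicator_of_notMem hs]
          refine le_of_eq (measure_mono_null (t := ∅) ?_ measure_empty)
          rintro y ⟨h1, h2, h3⟩
          simp only at h1 h2 h3
          exact hs ⟨by linarith, h1.le⟩
    _ = ENNReal.ofReal (∫ s in (p - t)..p, (s - (p - t))) := by
        rw [lintegral_indicator measurableSet_Ioc,
          intervalIntegral.integral_of_le (by linarith),
          ofReal_integral_eq_lintegral_ofReal]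
        · exact (continuous_id.sub continuous_const).integrableOn_Ioc
        · exact (ae_restrict_mem measurableSet_Ioc).mono fun s hs => by
            have := hs.1
            simp only [Pi.zero_apply]; linarith
    _ = _ := by
        congr 1
        rw [intervalIntegral.integral_sub (by simp) (by simp), integral_id]
        simp
        ring

/-- The area of the hexagon `|x| < a / 2`, `|y| < b / 2`, `|x + y| < c / 2`: a rectangle without two
right triangles. -/
theorem le_rieszForm_centeredInterval {a b c t : ℝ} (ha : 0 ≤ a) (ht : 0 ≤ t)
    (htc : 2 * t = a + b - c) :
    ENNReal.ofReal (a * b) ≤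
      rieszForm (centeredInterval (.ofReal a)) (centeredInterval (.ofReal b))
        (centeredInterval (.ofReal c)) + ENNReal.ofReal (t ^ 2) := by
  set T₁ := {x : ℝ × ℝ | x.1 < a / 2 ∧ x.2 < b / 2 ∧ a / 2 + b / 2 - t ≤ x.1 + x.2} with hT₁
  have h₁ : volume T₁ ≤ ENNReal.ofReal (t ^ 2 / 2) := volume_corner_le _ _ _ ht
  have h₂ : volume (-T₁) ≤ ENNReal.ofReal (t ^ 2 / 2) := by
    rwa [Measure.measure_neg]
  rw [ENNReal.ofReal_mul ha]
  calc ENNReal.ofReal a * ENNReal.ofReal b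
      = volume (centeredInterval (.ofReal a) ×ˢ centeredInterval (.ofReal b)) := by
        rw [Measure.volume_eq_prod, Measure.prod_prod, volume_centeredInterval,
          volume_centeredInterval]
    _ ≤ volume ({p : ℝ × ℝ | p.1 ∈ centeredInterval (.ofReal a) ∧
          p.2 ∈ centeredInterval (.ofReal b) ∧ p.1 + p.2 ∈ centeredInterval (.ofReal c)} ∪
          (T₁ ∪ -T₁)) := by
        refine measure_mono ?_
        rintro ⟨x, y⟩ ⟨hx, hy⟩
        by_cases h : x + y ∈ centeredInterval (.ofReal c)
        · exact Or.inl ⟨hx, hy, h⟩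
        · right
          simp only [mem_centeredInterval_ofReal, abs_lt] at hx hy h
          simp only [hT₁, mem_union, mem_neg, mem_ofPred_eq, Prod.fst_neg, Prod.snd_neg]
          by_cases h' : x + y < c / 2
          · right
            have h3 : x + y ≤ -(c / 2) := by
              by_contra! h4
              exact h ⟨h4, h'⟩
            exact ⟨by linarith, by linarith, by linarith⟩
          · left
            exact ⟨hx.2, hy.2, by linarith⟩
    _ ≤ _ + (volume T₁ + volume (-T₁)) :=
        (measure_union_le _ _).trans (add_le_add le_rfl (measure_union_le _ _))
    _ ≤ _ + (ENNReal.ofReal (t ^ 2 / 2) + ENNReal.ofReal (t ^ 2 / 2)) := by gcongr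
    _ = _ := by
        rw [← ENNReal.ofReal_add (by positivity) (by positivity), add_halves]
        rfl

/-- **Riesz' rearrangement inequality** for sets of finite measure on the line. -/
theorem rieszForm_real_le_centeredInterval {A B C : Set ℝ} (hA : MeasurableSet A)
    (hB : MeasurableSet B) (hC : MeasurableSet C) (hAf : volume A ≠ ∞) (hBf : volume B ≠ ∞)
    (hCf : volume C ≠ ∞) :
    rieszForm A B C ≤ rieszForm (centeredInterval (volume A)) (centeredInterval (volume B))
      (centeredInterval (volume C)) := by
  obtain ⟨a, ha, ha'⟩ : ∃ a : ℝ, 0 ≤ a ∧ volume A = ENNReal.ofReal a :=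
    ⟨_, ENNReal.toReal_nonneg, (ENNReal.ofReal_toReal hAf).symm⟩
  obtain ⟨b, hb, hb'⟩ : ∃ a : ℝ, 0 ≤ a ∧ volume B = ENNReal.ofReal a :=
    ⟨_, ENNReal.toReal_nonneg, (ENNReal.ofReal_toReal hBf).symm⟩
  obtain ⟨c, hc, hc'⟩ : ∃ a : ℝ, 0 ≤ a ∧ volume C = ENNReal.ofReal a :=
    ⟨_, ENNReal.toReal_nonneg, (ENNReal.ofReal_toReal hCf).symm⟩
  have hI := measurableSet_centeredInterval
  have hV := volume_centeredInterval
  rcases le_or_gt (a + b) c with h | h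
  -- the constraint `x + y ∈ C` is void for the intervals
  · refine (rieszForm_le_mul A B C).trans ?_
    rw [← hV (volume A), ← hV (volume B), ← Measure.prod_prod, ← Measure.volume_eq_prod, hV, hV,
      ha', hb', hc']
    refine measure_mono ?_
    rintro ⟨x, y⟩ ⟨hx, hy⟩
    refine ⟨hx, hy, ?_⟩
    simp only [mem_centeredInterval_ofReal] at hx hy ⊢
    linarith [abs_add_le x y]
  rcases le_or_gt (b + c) a with h1 | h1
  · refine (rieszForm_le_mul_right hB hC).trans ?_
    rw [← hV (volume B), ← hV (volume C), ← volume_snd_mem_add_mem (hI _) (hI _), hV, hV,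
      ha', hb', hc']
    refine measure_mono ?_
    rintro ⟨x, y⟩ ⟨hy, hz⟩
    refine ⟨?_, hy, hz⟩
    simp only [mem_centeredInterval_ofReal, abs_lt] at hy hz ⊢
    exact ⟨by linarith, by linarith⟩
  rcases le_or_gt (a + c) b with h2 | h2
  · refine (rieszForm_le_mul_left hA hC).trans ?_
    rw [← hV (volume A), ← hV (volume C), ← volume_fst_mem_add_mem (hI _) (hI _), hV, hV,
      ha', hb', hc']
    refine measure_mono ?_
    rintro ⟨x, y⟩ ⟨hy, hz⟩
    refine ⟨hy, ?_, hz⟩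
    simp only [mem_centeredInterval_ofReal, abs_lt] at hy hz ⊢
    exact ⟨by linarith, by linarith⟩
  -- the optimal cut is `t = (a + b - c) / 2`
  · obtain ⟨t, ht⟩ : ∃ t : ℝ, 2 * t = a + b - c := ⟨(a + b - c) / 2, by ring⟩
    have ht0 : 0 < t := by linarith
    have hta : t < a := by linarith
    have htb : t < b := by linarith
    have hlow := le_rieszForm_centeredInterval ha ht0.le ht
    have hup := rieszForm_real_le hA hB hC hAf hBf (t := ENNReal.ofReal t)
      (by simpa using ht0) (by rw [ha']; exact (ENNReal.ofReal_lt_ofReal_iff (by linarith)).2 hta)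
      (by rw [hb']; exact (ENNReal.ofReal_lt_ofReal_iff (by linarith)).2 htb)
    have he : ENNReal.ofReal t * volume C + (volume A - ENNReal.ofReal t) *
        (volume B - ENNReal.ofReal t) + ENNReal.ofReal (t ^ 2) = ENNReal.ofReal (a * b) := by
      rw [ha', hb', hc', ← ENNReal.ofReal_sub _ ht0.le, ← ENNReal.ofReal_sub _ ht0.le,
        ← ENNReal.ofReal_mul ht0.le, ← ENNReal.ofReal_mul (by linarith),
        ← ENNReal.ofReal_add (by positivity) (mul_nonneg (by linarith) (by linarith)),
        ← ENNReal.ofReal_add (add_nonneg (by positivity)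
          (mul_nonneg (by linarith) (by linarith))) (by positivity)]
      congr 1
      have : c = a + b - 2 * t := by linarith
      rw [this]; ring
    rw [← he] at hlow
    rw [ha', hb', hc']
    rw [ha', hb', hc'] at hup hlow
    exact hup.trans ((ENNReal.add_le_add_iff_right ENNReal.ofReal_ne_top).1 hlow)

/-! ### Steiner symmetrization -/

/-- The Steiner symmetrization of a subset of `ℝ × F` along the first factor: each fibre over
`y : F` is replaced by the open interval of the same length centred at `0`. -/
def steiner {F : Type*} (A : Set (ℝ × F)) : Set (ℝ × F) :=
  {p | p.1 ∈ centeredInterval (volume {s | (s, p.2) ∈ A})}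

section Steiner
variable {F : Type*}

theorem fiber_steiner (A : Set (ℝ × F)) (y : F) :
    {s | (s, y) ∈ steiner A} = centeredInterval (volume {s | (s, y) ∈ A}) := rfl

theorem steiner_mono {A B : Set (ℝ × F)} (h : A ⊆ B) : steiner A ⊆ steiner B :=
  fun p hp => centeredInterval_mono (measure_mono fun s (hs : (s, p.2) ∈ A) => h hs) hp

theorem measurableSet_fiber [MeasurableSpace F] {A : Set (ℝ × F)} (hA : MeasurableSet A) (y : F) :
    MeasurableSet {s | (s, y) ∈ A} := measurable_prodMk_right hA

theorem measurableSet_steiner [MeasurableSpace F] {A : Set (ℝ × F)} (hA : MeasurableSet A) :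
    MeasurableSet (steiner A) :=
  measurableSet_lt (by fun_prop) ((measurable_measure_prodMk_right hA).comp measurable_snd)

theorem volume_eq_lintegral_fiber [MeasureSpace F] [SFinite (volume : Measure F)]
    {A : Set (ℝ × F)} (hA : MeasurableSet A) : volume A = ∫⁻ y, volume {s | (s, y) ∈ A} := by
  rw [Measure.volume_eq_prod, Measure.prod_apply_symm hA]
  rfl

theorem volume_steiner [MeasureSpace F] [SFinite (volume : Measure F)]
    {A : Set (ℝ × F)} (hA : MeasurableSet A) : volume (steiner A) = volume A := by
  rw [volume_eq_lintegral_fiber hA, volume_eq_lintegral_fiber (measurableSet_steiner hA)]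
  exact lintegral_congr fun y => by rw [fiber_steiner, volume_centeredInterval]

/-- Slicing along the fibres reduces the trilinear form on `ℝ × F` to the one on the line. -/
theorem rieszForm_eq_lintegral_fiber [MeasureSpace F] [SFinite (volume : Measure F)]
    [Add F] [MeasurableAdd₂ F] [MeasurableAdd₂ (ℝ × F)]
    {A B C : Set (ℝ × F)} (hA : MeasurableSet A) (hB : MeasurableSet B)
    (hC : MeasurableSet C) :
    rieszForm A B C = ∫⁻ y, ∫⁻ z, rieszForm {s | (s, y) ∈ A} {s | (s, z) ∈ B}
      {s | (s, y + z) ∈ C} := by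
  have hm := measurableSet_rieszForm hA hB hC
  have hstep : ∀ p : ℝ × F, volume {q : ℝ × F | p ∈ A ∧ q ∈ B ∧ p + q ∈ C} =
      ∫⁻ z, volume {t : ℝ | p ∈ A ∧ (t, z) ∈ B ∧ p + (t, z) ∈ C} := fun p => by
    rw [volume_eq_lintegral_fiber]
    · rfl
    · exact measurable_prodMk_left (x := p) hm
  have hm4 : MeasurableSet {x : (ℝ × F × F) × ℝ |
      (x.1.1, x.1.2.1) ∈ A ∧ (x.2, x.1.2.2) ∈ B ∧ (x.1.1 + x.2, x.1.2.1 + x.1.2.2) ∈ C} := by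
    exact ((by fun_prop : Measurable fun x : (ℝ × F × F) × ℝ => (x.1.1, x.1.2.1)) hA).inter
      (((by fun_prop : Measurable fun x : (ℝ × F × F) × ℝ => (x.2, x.1.2.2)) hB).inter
      ((by fun_prop : Measurable fun x : (ℝ × F × F) × ℝ =>
        (x.1.1 + x.2, x.1.2.1 + x.1.2.2)) hC))
  have hmeas : Measurable fun x : ℝ × F × F => volume {t : ℝ |
      (x.1, x.2.1) ∈ A ∧ (t, x.2.2) ∈ B ∧ (x.1 + t, x.2.1 + x.2.2) ∈ C} :=
    measurable_measure_prodMk_left hm4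
  rw [rieszForm, Measure.volume_eq_prod, Measure.prod_apply hm]
  calc _ = ∫⁻ p : ℝ × F, ∫⁻ z, volume {t : ℝ | p ∈ A ∧ (t, z) ∈ B ∧ p + (t, z) ∈ C} :=
        lintegral_congr hstep
    _ = ∫⁻ y, ∫⁻ s, ∫⁻ z, volume {t : ℝ | (s, y) ∈ A ∧ (t, z) ∈ B ∧ (s + t, y + z) ∈ C} := by
        rw [Measure.volume_eq_prod, lintegral_prod_symm]
        · rfl
        · refine Measurable.aemeasurable (Measurable.lintegral_prod_right' (f := fun x : (ℝ × F) × F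
            => volume {t : ℝ | x.1 ∈ A ∧ (t, x.2) ∈ B ∧ x.1 + (t, x.2) ∈ C}) ?_)
          exact hmeas.comp (g := _) (f := fun x : (ℝ × F) × F => (x.1.1, x.1.2, x.2))
            (by fun_prop)
    _ = _ := by
        refine lintegral_congr fun y => ?_
        rw [lintegral_lintegral_swap]
        · refine lintegral_congr fun z => ?_
          rw [rieszForm, Measure.volume_eq_prod, Measure.prod_apply]
          · rfl
          · exact measurableSet_rieszForm (measurableSet_fiber hA y) (measurableSet_fiber hB z)
              (measurableSet_fiber hC (y + z))
        · exact (hmeas.comp (f := fun x : ℝ × F => (x.1, y, x.2)) (by fun_prop)).aemeasurable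

/-- Steiner symmetrization of three sets does not decrease the trilinear form: apply the inequality
on the line to each triple of fibres. -/
theorem rieszForm_le_steiner [MeasureSpace F] [SFinite (volume : Measure F)]
    [Add F] [MeasurableAdd₂ F] [MeasurableAdd₂ (ℝ × F)]
    {A B C : Set (ℝ × F)} (hA : MeasurableSet A) (hB : MeasurableSet B)
    (hC : MeasurableSet C) (hAf : ∀ y, volume {s | (s, y) ∈ A} ≠ ∞)
    (hBf : ∀ y, volume {s | (s, y) ∈ B} ≠ ∞) (hCf : ∀ y, volume {s | (s, y) ∈ C} ≠ ∞) :
    rieszForm A B C ≤ rieszForm (steiner A) (steiner B) (steiner C) := by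
  rw [rieszForm_eq_lintegral_fiber hA hB hC, rieszForm_eq_lintegral_fiber
    (measurableSet_steiner hA) (measurableSet_steiner hB) (measurableSet_steiner hC)]
  exact lintegral_mono fun y => lintegral_mono fun z =>
    rieszForm_real_le_centeredInterval (measurableSet_fiber hA y) (measurableSet_fiber hB z)
      (measurableSet_fiber hC (y + z)) (hAf y) (hBf z) (hCf (y + z))

/-- Points of `I \ A` which a translation by `h` carries into `A \ I` count on both sides of
`|I| - |A| = |I \ A| - |A \ I|`, hence the gain. -/
theorem volume_centeredInterval_sdiff_add_le {A : Set ℝ} (hA : MeasurableSet A)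
    (hAf : volume A ≠ ∞) (l : ℝ≥0∞) (h : ℝ) :
    volume (centeredInterval l \ centeredInterval (volume A)) +
      volume {s | s ∈ centeredInterval l \ A ∧ s + h ∈ A \ centeredInterval l} ≤
      volume (centeredInterval l \ A) := by
  have hI := measurableSet_centeredInterval
  set M := {s | s ∈ centeredInterval l \ A ∧ s + h ∈ A \ centeredInterval l}
  have hM1 : volume M ≤ volume (centeredInterval l \ A) := measure_mono fun s hs => hs.1
  rcases le_total l (volume A) with hle | hle
  · rw [sdiff_eq_empty.2 (centeredInterval_mono hle), measure_empty, zero_add]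
    exact hM1
  · have hM2 : volume M ≤ volume (A \ centeredInterval l) := by
      rw [← (measurePreserving_add_right volume h).measure_preimage
        (hA.diff (hI l)).nullMeasurableSet]
      exact measure_mono fun s hs => hs.2
    rw [measure_sdiff (centeredInterval_mono hle) (hI _).nullMeasurableSet
      ((volume_centeredInterval _).trans_ne hAf), volume_centeredInterval,
      volume_centeredInterval]
    have e1 := measure_sdiff_add_inter (μ := volume) (centeredInterval l) hA
    have e2 := measure_sdiff_add_inter (μ := volume) A (hI l)
    rw [volume_centeredInterval, inter_comm] at e1
    have hfin : volume (A ∩ centeredInterval l) ≠ ∞ :=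
      ((measure_mono inter_subset_left).trans_lt hAf.lt_top).ne
    refine (add_le_add_right hM2 _).trans ?_
    have e3 : l - volume A = volume (centeredInterval l \ A) - volume (A \ centeredInterval l) := by
      rw [← ENNReal.add_sub_add_eq_sub_right (a := volume (centeredInterval l \ A)) hfin, e1, e2]
    rw [e3]
    rw [← e1, ← e2] at hle
    exact (tsub_add_cancel_of_le ((ENNReal.add_le_add_iff_right hfin).1 hle)).le

/-- Steiner symmetrization does not increase the distance to a Steiner symmetric set `W`, and
strictly decreases it if a translation along the fibres carries a part of `W \ A` of positive
measure into `A \ W`. -/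
theorem volume_sdiff_steiner_add_le [MeasureSpace F] [SFinite (volume : Measure F)]
    [AddZeroClass F] [MeasurableAdd₂ (ℝ × F)]
    {A W : Set (ℝ × F)} (hA : MeasurableSet A) (hW : MeasurableSet W) (hWs : steiner W = W)
    (hAf : ∀ y, volume {s | (s, y) ∈ A} ≠ ∞) (h : ℝ) :
    volume (W \ steiner A) + volume {p | p ∈ W \ A ∧ p + (h, 0) ∈ A \ W} ≤ volume (W \ A) := by
  have hM : MeasurableSet {p : ℝ × F | p ∈ W \ A ∧ p + (h, 0) ∈ A \ W} :=
    (hW.diff hA).inter ((measurable_add_const _) (hA.diff hW))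
  rw [volume_eq_lintegral_fiber (hW.diff (measurableSet_steiner hA)), volume_eq_lintegral_fiber hM,
    volume_eq_lintegral_fiber (hW.diff hA), ← lintegral_add_right]
  · refine lintegral_mono fun y => ?_
    have hw : {s | (s, y) ∈ W} = centeredInterval (volume {s | (s, y) ∈ W}) := by
      rw [← fiber_steiner, hWs]
    have := volume_centeredInterval_sdiff_add_le (measurableSet_fiber hA y) (hAf y)
      (volume {s | (s, y) ∈ W}) h
    rw [← hw] at this
    refine this.trans_eq' (congrArg _ (congrArg _ ?_))
    ext s
    simp
  · exact measurable_measure_prodMk_right hM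

end Steiner

/-! ### Orthogonal coordinates and one symmetrization step -/

section Coordinates
variable {V : Type*} [NormedAddCommGroup V] [InnerProductSpace ℝ V] [FiniteDimensional ℝ V]
  [MeasurableSpace V] [BorelSpace V]

/-- Orthogonal coordinates along a unit vector `u` and in the hyperplane orthogonal to `u`. -/
theorem exists_measurableEquiv_prod_orthogonal {u : V} (hu : ‖u‖ = 1) :
    ∃ g : V ≃ᵐ ℝ × (Submodule.span ℝ {u})ᗮ, MeasurePreserving g ∧
      (∀ x y, g (x + y) = g x + g y) ∧ (∀ c : ℝ, g (c • u) = (c, 0)) ∧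
      ∀ x, ‖x‖ ^ 2 = (g x).1 ^ 2 + ‖(g x).2‖ ^ 2 := by
  let K := Submodule.span ℝ {u}
  let e : V ≃ₗᵢ[ℝ] WithLp 2 (ℝ × Kᗮ) := K.orthogonalDecomposition.trans
    (LinearIsometryEquiv.withLpProdCongr 2
      (LinearIsometryEquiv.toSpanUnitSingleton (𝕜 := ℝ) u hu).symm (LinearIsometryEquiv.refl ℝ Kᗮ))
  refine ⟨e.toHomeomorph.toMeasurableEquiv.trans (MeasurableEquiv.toLp 2 (ℝ × Kᗮ)).symm,
    e.measurePreserving.trans (WithLp.volume_preserving_ofLp ℝ Kᗮ), fun x y => ?_, fun c => ?_,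
    fun x => ?_⟩
  · change WithLp.ofLp (e (x + y)) = WithLp.ofLp (e x) + WithLp.ofLp (e y)
    rw [map_add]; rfl
  · change WithLp.ofLp (e (c • u)) = _
    have : c • u = e.symm (WithLp.toLp 2 (c, 0)) := by
      simp [e, LinearIsometryEquiv.symm_trans]
      rfl
    rw [this, e.apply_symm_apply]
  · rw [← e.norm_map x, WithLp.prod_norm_sq_eq_of_L2]
    simp

theorem rieszForm_preimage {G H : Type*} [MeasureSpace G] [MeasureSpace H] [Add G] [Add H]
    [SFinite (volume : Measure G)] [SFinite (volume : Measure H)]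
    (g : G ≃ᵐ H) (hg : MeasurePreserving g) (hadd : ∀ x y, g (x + y) = g x + g y) (A B C : Set H) :
    rieszForm (g ⁻¹' A) (g ⁻¹' B) (g ⁻¹' C) = rieszForm A B C := by
  have h : MeasurePreserving (g.prodCongr g) (volume : Measure (G × G)) volume := hg.prod hg
  rw [rieszForm, rieszForm, ← h.measure_preimage_equiv]
  congr 1
  ext p
  change g p.1 ∈ A ∧ g p.2 ∈ B ∧ g (p.1 + p.2) ∈ C ↔ g p.1 ∈ A ∧ g p.2 ∈ B ∧ g p.1 + g p.2 ∈ C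
  rw [hadd]

/-- Sets whose fibres are centred open intervals, balls among them, are Steiner symmetric. -/
theorem steiner_eq_self_of_abs_lt {F : Type*} {W : Set (ℝ × F)} {ρ : F → ℝ}
    (h : ∀ p, p ∈ W ↔ |p.1| < ρ p.2) : steiner W = W := by
  ext ⟨s, y⟩
  have : {s | (s, y) ∈ W} = centeredInterval (.ofReal (2 * ρ y)) := by
    ext t
    rw [mem_centeredInterval_ofReal, mem_ofPred_eq, h]
    simp
  change s ∈ centeredInterval (volume {s | (s, y) ∈ W}) ↔ s ∈ {s | (s, y) ∈ W}
  rw [this, volume_centeredInterval]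

/-- One step of simultaneous Steiner symmetrization in the direction of `ξ`. -/
theorem exists_symmetrization_step {A : Fin 3 → Set V} (hA : ∀ i, MeasurableSet (A i)) {R : ℝ}
    (hR : 0 ≤ R) (hAR : ∀ i, A i ⊆ Metric.ball 0 R) {r : Fin 3 → ℝ} (hr : ∀ i, 0 ≤ r i) {ξ : V}
    (hξ : ξ ≠ 0) :
    ∃ A' : Fin 3 → Set V, (∀ i, MeasurableSet (A' i)) ∧ (∀ i, A' i ⊆ Metric.ball 0 R) ∧
      (∀ i, volume (A' i) = volume (A i)) ∧
      rieszForm (A 0) (A 1) (A 2) ≤ rieszForm (A' 0) (A' 1) (A' 2) ∧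
      ∀ i, volume (Metric.ball 0 (r i) \ A' i) +
        volume {p | p ∈ Metric.ball 0 (r i) \ A i ∧ p + ξ ∈ A i \ Metric.ball 0 (r i)} ≤
        volume (Metric.ball 0 (r i) \ A i) := by
  have hn : ‖ξ‖ ≠ 0 := norm_ne_zero_iff.2 hξ
  obtain ⟨g, hg, hadd, hgu, hnorm⟩ := exists_measurableEquiv_prod_orthogonal (u := ‖ξ‖⁻¹ • ξ)
    (by rw [norm_smul, norm_inv, norm_norm, inv_mul_cancel₀ hn])
  have hgξ : g ξ = (‖ξ‖, 0) := by
    rw [← hgu, smul_smul, mul_inv_cancel₀ hn, one_smul]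
  have hball : ∀ ρ : ℝ, 0 ≤ ρ → ∀ p, p ∈ g.symm ⁻¹' Metric.ball 0 ρ ↔
      |p.1| < √(ρ ^ 2 - ‖p.2‖ ^ 2) := fun ρ hρ p => by
    rw [Real.lt_sqrt (abs_nonneg _), sq_abs, mem_preimage, mem_ball_zero_iff,
      ← pow_lt_pow_iff_left₀ (norm_nonneg _) hρ two_ne_zero, hnorm, g.apply_symm_apply,
      lt_sub_iff_add_lt]
  have hst : ∀ ρ : ℝ, 0 ≤ ρ → steiner (g.symm ⁻¹' Metric.ball 0 ρ) = g.symm ⁻¹' Metric.ball 0 ρ :=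
    fun ρ hρ => steiner_eq_self_of_abs_lt (ρ := fun y => √(ρ ^ 2 - ‖y‖ ^ 2)) (hball ρ hρ)
  have hfin : ∀ ρ : ℝ, 0 ≤ ρ → ∀ y, volume {s | (s, y) ∈ g.symm ⁻¹' Metric.ball 0 ρ} ≠ ∞ :=
    fun ρ hρ y => by
      refine ne_top_of_le_ne_top ?_ (measure_mono (t := Ioo (-√(ρ ^ 2 - ‖y‖ ^ 2))
        (√(ρ ^ 2 - ‖y‖ ^ 2))) fun s hs => ?_)
      · rw [Real.volume_Ioo]; exact ENNReal.ofReal_ne_top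
      · exact abs_lt.1 ((hball ρ hρ (s, y)).1 hs)
  have hm : ∀ i, MeasurableSet (g.symm ⁻¹' A i) := fun i => g.symm.measurable (hA i)
  have hAf : ∀ i y, volume {s | (s, y) ∈ g.symm ⁻¹' A i} ≠ ∞ := fun i y =>
    ne_top_of_le_ne_top (hfin R hR y) (measure_mono fun s hs => hAR i hs)
  have hgs : ∀ S : Set V, g ⁻¹' (g.symm ⁻¹' S) = S := fun S => by
    ext x; simp
  refine ⟨fun i => g ⁻¹' steiner (g.symm ⁻¹' A i), fun i => g.measurable (measurableSet_steiner
    (hm i)), fun i => ?_, fun i => ?_, ?_, fun i => ?_⟩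
  · rw [← hgs (Metric.ball 0 R), ← hst R hR]
    exact preimage_mono (steiner_mono (preimage_mono (hAR i)))
  · rw [hg.measure_preimage_equiv, volume_steiner (hm i), ← hg.measure_preimage_equiv, hgs]
  · rw [rieszForm_preimage g hg hadd]
    refine le_trans (le_of_eq ?_) (rieszForm_le_steiner (hm 0) (hm 1) (hm 2) (hAf 0) (hAf 1)
      (hAf 2))
    rw [← rieszForm_preimage g hg hadd, hgs, hgs, hgs]
  · have key := volume_sdiff_steiner_add_le (hm i) (g.symm.measurable
      (measurableSet_ball (x := 0) (ε := r i))) (hst _ (hr i)) (hAf i) ‖ξ‖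
    rw [← hg.measure_preimage_equiv, ← hg.measure_preimage_equiv, ← hg.measure_preimage_equiv]
      at key
    rw [preimage_sdiff, preimage_sdiff, hgs, hgs] at key
    refine key.trans_eq' (congrArg _ (congrArg _ ?_))
    ext p
    simp [← hgξ, ← hadd]

/-- Averaging over translations. -/
theorem exists_le_sum_volume_translate {P Q : Fin 3 → Set V} (hP : ∀ i, MeasurableSet (P i))
    (hQ : ∀ i, MeasurableSet (Q i)) {R : ℝ} (hPR : ∀ i, P i ⊆ Metric.ball 0 R)
    (hQR : ∀ i, Q i ⊆ Metric.ball 0 R) {κ : ℝ≥0∞}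
    (hκ : κ * volume (Metric.ball (0 : V) (R + R)) < ∑ i, volume (P i) * volume (Q i)) :
    ∃ ξ, κ < ∑ i, volume {p | p ∈ P i ∧ p + ξ ∈ Q i} := by
  by_contra! hcon
  refine absurd hκ (not_lt.2 ?_)
  have hm : ∀ i, MeasurableSet {p : V × V | p.1 ∈ P i ∧ p.1 + p.2 ∈ Q i} := fun i =>
    (measurable_fst (hP i)).inter ((measurable_fst.add measurable_snd) (hQ i))
  calc ∑ i, volume (P i) * volume (Q i)
      = ∑ i, ∫⁻ ξ, volume {p | p ∈ P i ∧ p + ξ ∈ Q i} := by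
        refine Finset.sum_congr rfl fun i _ => ?_
        rw [← volume_fst_mem_add_mem (hP i) (hQ i), Measure.volume_eq_prod,
          Measure.prod_apply_symm (hm i)]
        rfl
    _ = ∫⁻ ξ, ∑ i, volume {p | p ∈ P i ∧ p + ξ ∈ Q i} := by
        rw [lintegral_finsetSum]
        exact fun i _ => measurable_measure_prodMk_right (hm i)
    _ ≤ ∫⁻ ξ, (Metric.ball (0 : V) (R + R)).indicator (fun _ => κ) ξ := by
        refine lintegral_mono fun ξ => ?_
        by_cases hξ : ξ ∈ Metric.ball (0 : V) (R + R)
        · rw [indicator_of_mem hξ]; exact hcon ξ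
        · rw [indicator_of_notMem hξ]
          refine (Finset.sum_eq_zero fun i _ => ?_).le
          refine measure_mono_null (t := ∅) ?_ measure_empty
          rintro p ⟨h1, h2⟩
          have h1 := mem_ball_zero_iff.1 (hPR i h1)
          have h2 := mem_ball_zero_iff.1 (hQR i h2)
          refine hξ (mem_ball_zero_iff.2 ?_)
          calc ‖ξ‖ = ‖(p + ξ) - p‖ := by rw [add_sub_cancel_left]
            _ ≤ _ := norm_sub_le _ _
            _ < R + R := add_lt_add h2 h1
    _ = _ := by rw [lintegral_indicator_const measurableSet_ball]

end Coordinates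

/-! ### Riesz inequality in Euclidean space -/

section Riesz
variable {V : Type*} [NormedAddCommGroup V] [InnerProductSpace ℝ V] [FiniteDimensional ℝ V]
  [MeasurableSpace V] [BorelSpace V]

/-- Finitely many Steiner symmetrizations bring three bounded sets as close as desired to the balls
with the same volumes. As long as the total distance `∑ |B i \ A i|` is at least `ε`, some
symmetrization lowers it by a fixed amount `κ`, so this cannot go on for ever. -/
theorem exists_symmetrization_close {A : Fin 3 → Set V} (hA : ∀ i, MeasurableSet (A i)) {R : ℝ}
    (hR : 0 ≤ R) (hAR : ∀ i, A i ⊆ Metric.ball 0 R) {r : Fin 3 → ℝ} (hr : ∀ i, 0 ≤ r i)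
    (hrR : ∀ i, r i ≤ R) (hvol : ∀ i, volume (Metric.ball (0 : V) (r i)) = volume (A i))
    {ε : ℝ≥0∞} (hε : 0 < ε) :
    ∃ A' : Fin 3 → Set V, (∀ i, MeasurableSet (A' i)) ∧
      (∀ i, volume (A' i) = volume (A i)) ∧
      rieszForm (A 0) (A 1) (A 2) ≤ rieszForm (A' 0) (A' 1) (A' 2) ∧
      ∑ i, volume (Metric.ball 0 (r i) \ A' i) < ε := by
  by_contra! hcon
  have hBfin : ∀ ρ, volume (Metric.ball (0 : V) ρ) ≠ ∞ := fun ρ => measure_ball_lt_top.ne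
  -- `κ` is smaller than the average over translations in a ball of radius `2 R` of the gain,
  -- which is at least `(ε / 3) ^ 2` divided by the volume of that ball
  obtain ⟨κ, hκ0, hκ⟩ : ∃ κ : ℝ≥0∞, 0 < κ ∧
      κ * volume (Metric.ball (0 : V) (R + R)) < (ε / 3) * (ε / 3) := by
    have hpos : 0 < (ε / 3) * (ε / 3) := by
      have : ε / 3 ≠ 0 := (ENNReal.div_pos hε.ne' (by simp)).ne'
      exact pos_iff_ne_zero.2 (mul_ne_zero this this)
    have hcont : Filter.Tendsto (fun κ : ℝ≥0∞ => κ * volume (Metric.ball (0 : V) (R + R)))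
        (nhds 0) (nhds (0 * volume (Metric.ball (0 : V) (R + R)))) :=
      ENNReal.Tendsto.mul_const Filter.tendsto_id (Or.inr (hBfin _))
    rw [zero_mul] at hcont
    have h1 := (tendsto_order.1 hcont).2 _ hpos
    have : (nhdsWithin (0 : ℝ≥0∞) (Ioi 0)).NeBot := inferInstance
    obtain ⟨κ, h2, h3⟩ := ((h1.filter_mono nhdsWithin_le_nhds).and
      (self_mem_nhdsWithin (s := Ioi (0 : ℝ≥0∞)))).exists
    exact ⟨κ, h3, h2⟩
  -- after `n` symmetrizations the total distance has dropped by `n * κ`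
  have hstep : ∀ n : ℕ, ∃ A' : Fin 3 → Set V, (∀ i, MeasurableSet (A' i)) ∧
      (∀ i, A' i ⊆ Metric.ball 0 R) ∧ (∀ i, volume (A' i) = volume (A i)) ∧
      rieszForm (A 0) (A 1) (A 2) ≤ rieszForm (A' 0) (A' 1) (A' 2) ∧
      ∑ i, volume (Metric.ball 0 (r i) \ A' i) + n * κ ≤
        ∑ i, volume (Metric.ball 0 (r i) \ A i) := by
    intro n
    induction n with
    | zero => exact ⟨A, hA, hAR, fun _ => rfl, le_rfl, by simp⟩
    | succ n ih =>
      obtain ⟨A', hm, hb, hv, hT, hd⟩ := ih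
      have hge := hcon A' hm hv hT
      have hsymm : ∀ i, volume (A' i \ Metric.ball 0 (r i)) =
          volume (Metric.ball 0 (r i) \ A' i) := fun i =>
        measure_sdiff_symm (hm i).nullMeasurableSet measurableSet_ball.nullMeasurableSet
          ((hv i).trans (hvol i).symm)
          (ne_top_of_le_ne_top (hBfin (r i)) (measure_mono inter_subset_right))
      have hbig : ∃ i, ε / 3 ≤ volume (Metric.ball 0 (r i) \ A' i) := by
        by_contra! hlt
        refine absurd hge (not_le.2 ?_)
        calc ∑ i, volume (Metric.ball 0 (r i) \ A' i) < ∑ _i : Fin 3, ε / 3 :=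
              ENNReal.sum_lt_sum_of_nonempty Finset.univ_nonempty fun i _ => hlt i
          _ = ε := by
              rw [Finset.sum_const, Finset.card_univ, Fintype.card_fin, nsmul_eq_mul]
              exact ENNReal.mul_div_cancel (by simp) (by simp)
      obtain ⟨j, hj⟩ := hbig
      obtain ⟨ξ, hξ⟩ := exists_le_sum_volume_translate
        (P := fun i => Metric.ball 0 (r i) \ A' i) (Q := fun i => A' i \ Metric.ball 0 (r i))
        (fun i => measurableSet_ball.diff (hm i)) (fun i => (hm i).diff measurableSet_ball)
        (fun i => sdiff_subset.trans (Metric.ball_subset_ball (hrR i)))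
        (fun i => sdiff_subset.trans (hb i)) (κ := κ) (by
          refine hκ.trans_le (le_trans ?_ (Finset.single_le_sum (fun _ _ => zero_le)
            (Finset.mem_univ j)))
          rw [hsymm]
          exact mul_le_mul' hj hj)
      have hξ0 : ξ ≠ 0 := by
        rintro rfl
        refine absurd hξ (not_lt.2 (le_trans (le_of_eq (Finset.sum_eq_zero fun i _ => ?_))
          zero_le))
        refine measure_mono_null (t := ∅) ?_ measure_empty
        rintro p ⟨h1, h2⟩
        rw [add_zero] at h2
        exact h1.2 h2.1
      obtain ⟨A'', hm', hb', hv', hT', hd'⟩ := exists_symmetrization_step hm hR hb hr hξ0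
      refine ⟨A'', hm', hb', fun i => (hv' i).trans (hv i), hT.trans hT', le_trans ?_ hd⟩
      have := Finset.sum_le_sum fun i (_ : i ∈ Finset.univ) => hd' i
      rw [Finset.sum_add_distrib] at this
      calc _ = (∑ i, volume (Metric.ball 0 (r i) \ A'' i) + κ) + n * κ := by push_cast; ring
        _ ≤ _ := by gcongr; exact le_trans (by gcongr) this
  have hfin : ∑ i, volume (Metric.ball 0 (r i) \ A i) ≠ ∞ :=
    ENNReal.sum_ne_top.2 fun i _ =>
      ne_top_of_le_ne_top (hBfin (r i)) (measure_mono sdiff_subset)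
  obtain ⟨n, hn⟩ := ENNReal.exists_nat_mul_gt hκ0.ne' hfin
  obtain ⟨A', -, -, -, -, h⟩ := hstep n
  exact absurd (hn.trans_le (le_add_self.trans h)) (lt_irrefl _)

/-- Continuity of the trilinear form in the measure of the difference of the sets. -/
theorem rieszForm_le_add {A W : Fin 3 → Set V} (hA : ∀ i, MeasurableSet (A i))
    (hW : ∀ i, MeasurableSet (W i)) :
    rieszForm (A 0) (A 1) (A 2) ≤ rieszForm (W 0) (W 1) (W 2) +
      (volume (A 0) + volume (A 1)) * ∑ i, volume (A i \ W i) := by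
  have hsub : {p : V × V | p.1 ∈ A 0 ∧ p.2 ∈ A 1 ∧ p.1 + p.2 ∈ A 2} ⊆
      {p | p.1 ∈ W 0 ∧ p.2 ∈ W 1 ∧ p.1 + p.2 ∈ W 2} ∪ (((A 0 \ W 0) ×ˢ A 1) ∪
      ((A 0 ×ˢ (A 1 \ W 1)) ∪ {p | p.1 ∈ A 0 ∧ p.1 + p.2 ∈ A 2 \ W 2})) := by
    rintro ⟨x, y⟩ ⟨h0, h1, h2⟩
    simp only at h0 h1 h2
    simp only [mem_union, mem_ofPred_eq, mem_prod, mem_sdiff]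
    tauto
  calc _ ≤ _ := measure_mono hsub
    _ ≤ rieszForm (W 0) (W 1) (W 2) + (volume (A 0 \ W 0) * volume (A 1) +
        (volume (A 0) * volume (A 1 \ W 1) + volume (A 0) * volume (A 2 \ W 2))) := by
      refine (measure_union_le _ _).trans (add_le_add le_rfl ((measure_union_le _ _).trans
        (add_le_add ?_ ((measure_union_le _ _).trans (add_le_add ?_ ?_)))))
      · rw [Measure.volume_eq_prod, Measure.prod_prod]
      · rw [Measure.volume_eq_prod, Measure.prod_prod]
      · rw [volume_fst_mem_add_mem (hA 0) ((hA 2).diff (hW 2))]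
    _ ≤ rieszForm (W 0) (W 1) (W 2) + (volume (A 0 \ W 0) * (volume (A 0) + volume (A 1)) +
        ((volume (A 0) + volume (A 1)) * volume (A 1 \ W 1) +
          (volume (A 0) + volume (A 1)) * volume (A 2 \ W 2))) := by
      gcongr
      · exact le_add_self
      · exact le_self_add
      · exact le_self_add
    _ = _ := by rw [Fin.sum_univ_three]; ring

/-- Riesz' inequality for bounded sets. -/
theorem rieszForm_le_ball_of_bounded {A : Fin 3 → Set V} (hA : ∀ i, MeasurableSet (A i)) {R : ℝ}
    (hR : 0 ≤ R) (hAR : ∀ i, A i ⊆ Metric.ball 0 R) {r : Fin 3 → ℝ} (hr : ∀ i, 0 ≤ r i)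
    (hvol : ∀ i, volume (Metric.ball (0 : V) (r i)) = volume (A i)) :
    rieszForm (A 0) (A 1) (A 2) ≤ rieszForm (Metric.ball 0 (r 0)) (Metric.ball 0 (r 1))
      (Metric.ball (0 : V) (r 2)) := by
  set M := volume (A 0) + volume (A 1) with hM
  have hMfin : M ≠ ∞ := by
    rw [hM, ← hvol, ← hvol]
    exact ENNReal.add_ne_top.2 ⟨measure_ball_lt_top.ne, measure_ball_lt_top.ne⟩
  have hS : 0 ≤ ∑ i, r i := Finset.sum_nonneg fun i _ => hr i
  refine ENNReal.le_of_forall_pos_le_add fun ε hε _ => ?_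
  obtain ⟨A', hm, hv, hT, hd⟩ := exists_symmetrization_close hA (add_nonneg hR hS)
    (fun i => (hAR i).trans (Metric.ball_subset_ball (by linarith))) hr
    (fun i => (Finset.single_le_sum (fun j _ => hr j) (Finset.mem_univ i)).trans (by linarith))
    hvol (ε := ε / (M + 1)) (ENNReal.div_pos (by exact_mod_cast hε.ne') (by simp [hMfin]))
  refine hT.trans ((rieszForm_le_add hm (W := fun i => Metric.ball 0 (r i))
    fun i => measurableSet_ball).trans (add_le_add le_rfl ?_))
  rw [hv, hv, ← hM]
  have hsymm : ∀ i, volume (A' i \ Metric.ball 0 (r i)) =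
      volume (Metric.ball 0 (r i) \ A' i) := fun i =>
    measure_sdiff_symm (hm i).nullMeasurableSet measurableSet_ball.nullMeasurableSet
      ((hv i).trans (hvol i).symm)
      (ne_top_of_le_ne_top (measure_ball_lt_top (x := (0 : V)) (r := r i)).ne
        (measure_mono inter_subset_right))
  simp_rw [hsymm]
  calc _ ≤ (M + 1) * (ε / (M + 1)) := by gcongr; exact le_self_add
    _ = ε := ENNReal.mul_div_cancel (by simp) (by simp [hMfin])

end Riesz

section VolBall
variable {N : ℕ}

theorem volume_volBall (hN : 1 ≤ N) (x : EuclideanSpace ℝ (Fin N)) {m : ℝ≥0∞} (hm : m ≠ ∞) :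
    volume (volBall x m) = m := by
  have : Nontrivial (EuclideanSpace ℝ (Fin N)) := by
    have : Nonempty (Fin N) := ⟨⟨0, hN⟩⟩
    infer_instance
  set ω := volume (Metric.ball (0 : EuclideanSpace ℝ (Fin N)) 1) with hω
  have hω0 : ω ≠ 0 := (Metric.measure_ball_pos _ _ one_pos).ne'
  have hω1 : ω ≠ ∞ := measure_ball_lt_top.ne
  have hN0 : (N : ℝ) ≠ 0 := by positivity
  rw [volBall, Measure.addHaar_ball _ _ ENNReal.toReal_nonneg, ← hω, finrank_euclideanSpace,
    Fintype.card_fin, ← ENNReal.toReal_pow, ENNReal.ofReal_toReal, ← ENNReal.rpow_natCast,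
    ← ENNReal.rpow_mul, one_div_mul_cancel hN0, ENNReal.rpow_one,
    ENNReal.div_mul_cancel hω0 hω1]
  exact ENNReal.pow_ne_top (ENNReal.rpow_ne_top_of_nonneg (by positivity)
    (ENNReal.div_ne_top hm hω0))

theorem volBall_mono {x : EuclideanSpace ℝ (Fin N)} {m m' : ℝ≥0∞} (h : m ≤ m') (hm' : m' ≠ ∞) :
    volBall x m ⊆ volBall x m' := by
  refine Metric.ball_subset_ball (ENNReal.toReal_mono ?_ (by gcongr))
  exact ENNReal.rpow_ne_top_of_nonneg (by positivity)
    (ENNReal.div_ne_top hm' (Metric.measure_ball_pos _ _ one_pos).ne')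

theorem rieszForm_mono {G : Type*} [MeasureSpace G] [Add G] {A B C A' B' C' : Set G} (hA : A ⊆ A')
    (hB : B ⊆ B') (hC : C ⊆ C') : rieszForm A B C ≤ rieszForm A' B' C' :=
  measure_mono fun _ h => ⟨hA h.1, hB h.2.1, hC h.2.2⟩

/-- **Riesz' rearrangement inequality** for three sets of finite measure in `ℝ^N`. -/
theorem rieszForm_le_symmRearr (hN : 1 ≤ N) {A B C : Set (EuclideanSpace ℝ (Fin N))}
    (hA : MeasurableSet A) (hB : MeasurableSet B) (hC : MeasurableSet C) (hAf : volume A ≠ ∞)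
    (hBf : volume B ≠ ∞) (hCf : volume C ≠ ∞) :
    rieszForm A B C ≤ rieszForm (symmRearr A) (symmRearr B) (symmRearr C) := by
  have hU : {p : EuclideanSpace ℝ (Fin N) × EuclideanSpace ℝ (Fin N) |
      p.1 ∈ A ∧ p.2 ∈ B ∧ p.1 + p.2 ∈ C} = ⋃ n : ℕ, {p | p.1 ∈ A ∩ Metric.ball 0 n ∧
        p.2 ∈ B ∩ Metric.ball 0 n ∧ p.1 + p.2 ∈ C ∩ Metric.ball 0 n} := by
    ext p
    simp only [mem_ofPred_eq, mem_iUnion, mem_inter_iff, mem_ball_zero_iff]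
    constructor
    · rintro ⟨h1, h2, h3⟩
      obtain ⟨n, hn⟩ := exists_nat_gt (max ‖p.1‖ (max ‖p.2‖ ‖p.1 + p.2‖))
      simp only [max_lt_iff] at hn
      exact ⟨n, ⟨h1, hn.1⟩, ⟨h2, hn.2.1⟩, ⟨h3, hn.2.2⟩⟩
    · rintro ⟨n, h⟩
      exact ⟨h.1.1, h.2.1.1, h.2.2.1⟩
  rw [rieszForm, hU]
  refine le_of_tendsto' (tendsto_measure_iUnion_atTop fun i j hij p hp => ?_) fun n => ?_
  · have hb := Metric.ball_subset_ball (x := (0 : EuclideanSpace ℝ (Fin N)))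
      (Nat.cast_le (α := ℝ).2 hij)
    exact ⟨⟨hp.1.1, hb hp.1.2⟩, ⟨hp.2.1.1, hb hp.2.1.2⟩, ⟨hp.2.2.1, hb hp.2.2.2⟩⟩
  · have hfin : ∀ D : Set (EuclideanSpace ℝ (Fin N)), volume D ≠ ∞ →
        volume (D ∩ Metric.ball 0 n) ≠ ∞ := fun D hD =>
      ne_top_of_le_ne_top hD (measure_mono inter_subset_left)
    have hmono : ∀ D : Set (EuclideanSpace ℝ (Fin N)), volume D ≠ ∞ →
        symmRearr (D ∩ Metric.ball 0 n) ⊆ symmRearr D := fun D hD =>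
      volBall_mono (measure_mono inter_subset_left) hD
    let T : Fin 3 → Set (EuclideanSpace ℝ (Fin N)) := ![A, B, C]
    have hT : ∀ i, MeasurableSet (T i) := fun i => by fin_cases i <;> assumption
    have hTf : ∀ i, volume (T i) ≠ ∞ := fun i => by fin_cases i <;> assumption
    refine (rieszForm_le_ball_of_bounded (A := fun i => T i ∩ Metric.ball 0 n)
      (r := fun i => ((volume (T i ∩ Metric.ball 0 n) /
        volume (Metric.ball (0 : EuclideanSpace ℝ (Fin N)) 1)) ^ (1 / (N : ℝ))).toReal)
      (fun i => (hT i).inter measurableSet_ball) n.cast_nonneg (fun i => inter_subset_right)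
      (fun i => ENNReal.toReal_nonneg)
      (fun i => volume_volBall hN 0 (hfin _ (hTf i)))).trans ?_
    exact rieszForm_mono (hmono A hAf) (hmono B hBf) (hmono C hCf)

end VolBall

/-! ### The perimeter inequality via superlevel sets -/

section Perimeter
variable {N : ℕ}

theorem nonlocalPer_congr_kernel {k k' : EuclideanSpace ℝ (Fin N) → ℝ≥0∞} (h : k =ᵐ[volume] k')
    (E : Set (EuclideanSpace ℝ (Fin N))) : nonlocalPer k E = nonlocalPer k' E := by
  refine lintegral_congr fun x => lintegral_congr_ae (ae_restrict_of_ae ?_)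
  exact (Measure.measurePreserving_sub_left volume x).quasiMeasurePreserving.ae_eq_comp h

theorem nonlocalPer_congr_set (k : EuclideanSpace ℝ (Fin N) → ℝ≥0∞)
    {E E' : Set (EuclideanSpace ℝ (Fin N))} (h : E =ᵐ[volume] E') :
    nonlocalPer k E = nonlocalPer k E' := by
  rw [nonlocalPer, nonlocalPer, Measure.restrict_congr_set h,
    Measure.restrict_congr_set h.compl]

/-- For the kernel `χ_G`, the pairs in `E × E` and those in `E × Eᶜ` together have measure
`|E| |G|`. -/
theorem nonlocalPer_indicator_add_rieszForm {G E : Set (EuclideanSpace ℝ (Fin N))}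
    (hG : MeasurableSet G) (hE : MeasurableSet E) :
    nonlocalPer (G.indicator 1) E + rieszForm G E E = volume E * volume G := by
  have h1 : ∀ x, ∫⁻ y in Eᶜ, G.indicator 1 (x - y) = volume ({y | x - y ∈ G} \ E) := fun x => by
    have hm : MeasurableSet {y | x - y ∈ G} := (measurable_const.sub measurable_id) hG
    rw [← lintegral_indicator_one (hm.diff hE), ← lintegral_indicator hE.compl]
    refine lintegral_congr fun y => ?_
    by_cases hy : y ∈ E <;> by_cases hy' : x - y ∈ G <;> simp [hy, hy']
  have h2 : rieszForm G E E = ∫⁻ x in E, volume ({y | x - y ∈ G} ∩ E) := by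
    have hp := measurePreserving_sub_prod (G := EuclideanSpace ℝ (Fin N)) volume volume
    have hm := measurableSet_rieszForm hG hE hE
    rw [rieszForm, Measure.volume_eq_prod, ← hp.measure_preimage hm.nullMeasurableSet,
      Measure.prod_apply (hp.measurable hm), ← lintegral_indicator hE]
    refine lintegral_congr fun x => ?_
    by_cases hx : x ∈ E
    · rw [indicator_of_mem hx]
      congr 1
      ext y
      simp [hx]
    · rw [indicator_of_notMem hx]
      refine measure_mono_null (t := ∅) ?_ measure_empty
      rintro y hy
      simp [hx] at hy
  rw [nonlocalPer, h2, lintegral_congr h1, ← lintegral_add_left']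
  · have : ∀ x, volume ({y | x - y ∈ G} \ E) + volume ({y | x - y ∈ G} ∩ E) = volume G :=
      fun x => by
        rw [measure_sdiff_add_inter _ hE]
        exact (Measure.measurePreserving_sub_left volume x).measure_preimage hG.nullMeasurableSet
    rw [lintegral_congr this, setLIntegral_const, mul_comm]
  · refine (measurable_measure_prodMk_left (s := {p : EuclideanSpace ℝ (Fin N) ×
      EuclideanSpace ℝ (Fin N) | p.1 - p.2 ∈ G ∧ p.2 ∉ E}) ?_).aemeasurable
    exact ((measurable_fst.sub measurable_snd) hG).inter (measurable_snd hE).compl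

/-- The perimeter inequality for the kernel `χ_G`. -/
theorem nonlocalPer_indicator_symmRearr_le (hN : 1 ≤ N) {G E : Set (EuclideanSpace ℝ (Fin N))}
    (hG : MeasurableSet G) (hE : MeasurableSet E) (hGf : volume G ≠ ∞) (hEf : volume E ≠ ∞) :
    nonlocalPer ((symmRearr G).indicator 1) (symmRearr E) ≤ nonlocalPer (G.indicator 1) E := by
  have h1 := nonlocalPer_indicator_add_rieszForm hG hE
  have h2 := nonlocalPer_indicator_add_rieszForm (G := symmRearr G) (E := symmRearr E)
    measurableSet_ball measurableSet_ball
  rw [symmRearr, symmRearr, volume_volBall hN _ hGf, volume_volBall hN _ hEf, ← symmRearr,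
    ← symmRearr, ← h1] at h2
  have hT := rieszForm_le_symmRearr hN hG hE hE hGf hEf hEf
  have hfin : rieszForm (symmRearr G) (symmRearr E) (symmRearr E) ≠ ∞ := by
    refine ne_top_of_le_ne_top ?_ (rieszForm_le_mul _ _ _)
    rw [symmRearr, symmRearr, volume_volBall hN _ hGf, volume_volBall hN _ hEf]
    exact ENNReal.mul_ne_top hGf hEf
  refine (ENNReal.add_le_add_iff_right hfin).1 (h2.le.trans ?_)
  gcongr

/-- The perimeter is additive over kernels that are integrals of characteristic functions. -/
theorem nonlocalPer_lintegral_indicator {S : Set (ℝ × EuclideanSpace ℝ (Fin N))}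
    (hS : MeasurableSet S) (E : Set (EuclideanSpace ℝ (Fin N))) :
    nonlocalPer (fun z => ∫⁻ t in Ioi (0 : ℝ), {z | (t, z) ∈ S}.indicator 1 z) E =
      ∫⁻ t in Ioi (0 : ℝ), nonlocalPer ({z | (t, z) ∈ S}.indicator 1) E := by
  have hm : Measurable fun p : EuclideanSpace ℝ (Fin N) × EuclideanSpace ℝ (Fin N) × ℝ =>
      {z | (p.2.2, z) ∈ S}.indicator (1 : EuclideanSpace ℝ (Fin N) → ℝ≥0∞) (p.1 - p.2.1) :=
    (measurable_one.indicator hS).comp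
      (f := fun p : EuclideanSpace ℝ (Fin N) × EuclideanSpace ℝ (Fin N) × ℝ =>
        (p.2.2, p.1 - p.2.1)) (by fun_prop)
  simp only [nonlocalPer]
  have h1 : ∀ x, ∫⁻ y in Eᶜ, ∫⁻ t in Ioi (0 : ℝ), {z | (t, z) ∈ S}.indicator 1 (x - y) =
      ∫⁻ t in Ioi (0 : ℝ), ∫⁻ y in Eᶜ, {z | (t, z) ∈ S}.indicator 1 (x - y) := fun x =>
    lintegral_lintegral_swap (hm.comp (f := fun q : EuclideanSpace ℝ (Fin N) × ℝ => (x, q))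
      (by fun_prop)).aemeasurable
  rw [lintegral_congr h1]
  refine lintegral_lintegral_swap (Measurable.aemeasurable ?_)
  refine Measurable.lintegral_prod_right' (f := fun q : (EuclideanSpace ℝ (Fin N) × ℝ) ×
    EuclideanSpace ℝ (Fin N) => {z | (q.1.2, z) ∈ S}.indicator
      (1 : EuclideanSpace ℝ (Fin N) → ℝ≥0∞) (q.1.1 - q.2)) ?_
  exact hm.comp (f := fun q : (EuclideanSpace ℝ (Fin N) × ℝ) × EuclideanSpace ℝ (Fin N) =>
    (q.1.1, q.2, q.1.2)) (by fun_prop)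

theorem lintegral_Ioi_indicator_lt (a : ℝ≥0∞) :
    ∫⁻ t in Ioi (0 : ℝ), {t : ℝ | ENNReal.ofReal t < a}.indicator 1 t = a := by
  have hm : MeasurableSet {t : ℝ | ENNReal.ofReal t < a} :=
    measurableSet_lt ENNReal.measurable_ofReal measurable_const
  rw [lintegral_indicator_one hm, Measure.restrict_apply hm]
  rcases eq_or_ne a ∞ with rfl | ha
  · simp
  · have : {t : ℝ | ENNReal.ofReal t < a} ∩ Ioi 0 = Ioo 0 a.toReal := by
      ext t
      simp only [mem_inter_iff, mem_ofPred_eq, mem_Ioi, mem_Ioo]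
      constructor
      · rintro ⟨h1, h2⟩
        exact ⟨h2, (ENNReal.ofReal_lt_iff_lt_toReal h2.le ha).1 h1⟩
      · rintro ⟨h1, h2⟩
        exact ⟨(ENNReal.ofReal_lt_iff_lt_toReal h1.le ha).2 h2, h1⟩
    rw [this, Real.volume_Ioo, sub_zero, ENNReal.ofReal_toReal ha]

/-- Layer-cake formula for the perimeter. -/
theorem nonlocalPer_eq_lintegral_superlevel {k : EuclideanSpace ℝ (Fin N) → ℝ≥0∞}
    (hk : Measurable k) (E : Set (EuclideanSpace ℝ (Fin N))) :
    nonlocalPer k E =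
      ∫⁻ t in Ioi (0 : ℝ), nonlocalPer ({z | ENNReal.ofReal t < k z}.indicator 1) E := by
  have hS : MeasurableSet {p : ℝ × EuclideanSpace ℝ (Fin N) | ENNReal.ofReal p.1 < k p.2} :=
    measurableSet_lt (by fun_prop) (by fun_prop)
  calc nonlocalPer k E = nonlocalPer (fun z => ∫⁻ t in Ioi (0 : ℝ),
        {z | ENNReal.ofReal t < k z}.indicator 1 z) E := by
        congr 1
        funext z
        exact (lintegral_Ioi_indicator_lt (k z)).symm
    _ = _ := nonlocalPer_lintegral_indicator hS E

/-- Layer-cake formula for the rearranged kernel. -/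
theorem nonlocalPer_symmDecrRearr (h : EuclideanSpace ℝ (Fin N) → ℝ≥0∞)
    (E : Set (EuclideanSpace ℝ (Fin N))) :
    nonlocalPer (symmDecrRearr h) E =
      ∫⁻ t in Ioi (0 : ℝ),
        nonlocalPer ((symmRearr {y | ENNReal.ofReal t < h y}).indicator 1) E := by
  have hanti : Antitone fun t : ℝ => volume {y | ENNReal.ofReal t < h y} := fun s t hst =>
    measure_mono fun y hy => (ENNReal.ofReal_le_ofReal hst).trans_lt hy
  have hr := hanti.measurable
  have hS : MeasurableSet {p : ℝ × EuclideanSpace ℝ (Fin N) |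
      p.2 ∈ symmRearr {y | ENNReal.ofReal p.1 < h y}} := by
    simp only [symmRearr, volBall, mem_ball_zero_iff]
    refine measurableSet_lt (by fun_prop) ?_
    exact (((hr.comp measurable_fst).div_const _).pow_const _).ennreal_toReal
  exact nonlocalPer_lintegral_indicator hS E

theorem aemeasurable_kernel (hN : 1 ≤ N) {K : EuclideanSpace ℝ (Fin N) → ℝ≥0}
    (hint : Integrable (fun x => min ‖x‖ 1 * (K x : ℝ)) volume) :
    AEMeasurable (fun x => (K x : ℝ≥0∞)) volume := by
  have : Nonempty (Fin N) := ⟨⟨0, hN⟩⟩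
  have h1 : AEMeasurable (fun x => ENNReal.ofReal ((min ‖x‖ 1)⁻¹ * (min ‖x‖ 1 * (K x : ℝ))))
      volume :=
    ((by fun_prop : Measurable fun x : EuclideanSpace ℝ (Fin N) =>
      (min ‖x‖ 1)⁻¹).aemeasurable.mul hint.aemeasurable).ennreal_ofReal
  refine h1.congr ?_
  filter_upwards [Measure.ae_ne volume (0 : EuclideanSpace ℝ (Fin N))] with x hx
  have : min ‖x‖ 1 ≠ 0 := (lt_min (norm_pos_iff.2 hx) one_pos).ne'
  rw [inv_mul_cancel_left₀ this, ENNReal.ofReal_coe_nnreal]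

/-- By Markov's inequality outside the unit ball. -/
theorem volume_superlevel_ne_top {K : EuclideanSpace ℝ (Fin N) → ℝ≥0}
    (hint : Integrable (fun x => min ‖x‖ 1 * (K x : ℝ)) volume) {t : ℝ} (ht : 0 < t) :
    volume {x | ENNReal.ofReal t < K x} ≠ ∞ := by
  have hsub : {x | ENNReal.ofReal t < K x} ⊆ Metric.ball 0 1 ∪
      {x | t ≤ min ‖x‖ 1 * (K x : ℝ)} := by
    intro x hx
    by_cases h : ‖x‖ < 1
    · exact Or.inl (mem_ball_zero_iff.2 h)
    · right
      rw [mem_ofPred_eq, min_eq_right (not_lt.1 h), one_mul]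
      rw [mem_ofPred_eq, ← ENNReal.ofReal_coe_nnreal] at hx
      exact ((ENNReal.ofReal_lt_ofReal_iff').1 hx).1.le
  exact ne_top_of_le_ne_top (ENNReal.add_ne_top.2 ⟨measure_ball_lt_top.ne,
    (hint.measure_ge_lt_top ht).ne⟩) ((measure_mono hsub).trans (measure_union_le _ _))

theorem symmRearr_congr {A B : Set (EuclideanSpace ℝ (Fin N))} (h : A =ᵐ[volume] B) :
    symmRearr A = symmRearr B := by
  rw [symmRearr, symmRearr, measure_congr h]

theorem nonlocalPer_symmDecrRearr_le (hN : 1 ≤ N) {K : EuclideanSpace ℝ (Fin N) → ℝ≥0}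
    (hint : Integrable (fun x => min ‖x‖ 1 * (K x : ℝ)) volume)
    {E : Set (EuclideanSpace ℝ (Fin N))} (hE : NullMeasurableSet E) (hEf : volume E ≠ ∞) :
    nonlocalPer (symmDecrRearr fun x => (K x : ℝ≥0∞)) (volBall 0 (volume E)) ≤
      nonlocalPer (fun x => (K x : ℝ≥0∞)) E := by
  obtain ⟨E', -, hE', hEE'⟩ := hE.exists_measurable_superset_ae_eq
  obtain ⟨k, hk, hKk⟩ := aemeasurable_kernel hN hint
  rw [← nonlocalPer_congr_set _ hEE', nonlocalPer_congr_kernel hKk,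
    nonlocalPer_eq_lintegral_superlevel hk, nonlocalPer_symmDecrRearr, ← measure_congr hEE']
  rw [← measure_congr hEE'] at hEf
  refine setLIntegral_mono' measurableSet_Ioi fun t ht => ?_
  have hG : {x | ENNReal.ofReal t < (K x : ℝ≥0∞)} =ᵐ[volume] {x | ENNReal.ofReal t < k x} := by
    filter_upwards [hKk] with x hx
    simp only [eq_iff_iff]
    change (_ < _) ↔ (_ < _)
    rw [hx]
  rw [symmRearr_congr hG]
  refine nonlocalPer_indicator_symmRearr_le hN (measurableSet_lt measurable_const hk) hE' ?_ hEf
  rw [← measure_congr hG]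
  exact volume_superlevel_ne_top hint ht

/-- A radial set which contains, with a point, all nonzero points closer to the origin is a centred
ball up to a null set. -/
theorem ae_eq_symmRearr (hN : 1 ≤ N) {A : Set (EuclideanSpace ℝ (Fin N))}
    (hA : NullMeasurableSet A) (hAf : volume A ≠ ∞)
    (h : ∀ x ∈ A, ∀ y, y ≠ 0 → x ≠ 0 → ‖y‖ ≤ ‖x‖ → y ∈ A) : A =ᵐ[volume] symmRearr A := by
  have : Nonempty (Fin N) := ⟨⟨0, hN⟩⟩
  have hv : volume (symmRearr A) = volume A := volume_volBall hN 0 hAf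
  have h0 := Measure.ae_ne volume (0 : EuclideanSpace ℝ (Fin N))
  -- either `A` reaches out of the ball and then contains all of it, or it lies in the ball
  by_cases hx : ∃ x ∈ A, x ≠ 0 ∧ x ∉ symmRearr A
  · obtain ⟨x, hxA, hx0, hx⟩ := hx
    refine (ae_eq_of_ae_subset_of_measure_ge (h0.mono fun y hy0 hy => ?_) hv.ge
      measurableSet_ball.nullMeasurableSet hAf).symm
    refine h x hxA y hy0 hx0 ?_
    have h1 := mem_ball_zero_iff.1 hy
    have h2 := not_lt.1 (mt mem_ball_zero_iff.2 hx)
    exact h1.le.trans h2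
  · push Not at hx
    exact ae_eq_of_ae_subset_of_measure_ge (h0.mono fun y hy0 hy => hx y hy hy0) hv.le
      hA (hv.trans_ne hAf)

/-- A radially decreasing kernel has the same perimeters as its rearrangement. -/
theorem nonlocalPer_symmDecrRearr_eq (hN : 1 ≤ N) {K : EuclideanSpace ℝ (Fin N) → ℝ≥0}
    (hint : Integrable (fun x => min ‖x‖ 1 * (K x : ℝ)) volume) (hK : RadiallyDecreasing K)
    (E : Set (EuclideanSpace ℝ (Fin N))) :
    nonlocalPer (symmDecrRearr fun x => (K x : ℝ≥0∞)) E =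
      nonlocalPer (fun x => (K x : ℝ≥0∞)) E := by
  obtain ⟨φ, hφ, hKφ⟩ := hK
  obtain ⟨k, hk, hKk⟩ := aemeasurable_kernel hN hint
  rw [nonlocalPer_congr_kernel hKk, nonlocalPer_eq_lintegral_superlevel hk,
    nonlocalPer_symmDecrRearr]
  refine setLIntegral_congr_fun measurableSet_Ioi fun t ht => ?_
  have hG : {x | ENNReal.ofReal t < (K x : ℝ≥0∞)} =ᵐ[volume] {x | ENNReal.ofReal t < k x} := by
    filter_upwards [hKk] with x hx
    simp only [eq_iff_iff]
    change (_ < _) ↔ (_ < _)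
    rw [hx]
  have hGm : NullMeasurableSet {x | ENNReal.ofReal t < (K x : ℝ≥0∞)} :=
    (measurableSet_lt measurable_const hk).nullMeasurableSet.congr hG.symm
  have := ae_eq_symmRearr hN hGm (volume_superlevel_ne_top hint ht) fun x hx y hy0 hx0 hyx => by
    rw [mem_ofPred_eq, hKφ y hy0]
    rw [mem_ofPred_eq, hKφ x hx0] at hx
    exact hx.trans_le (by exact_mod_cast hφ (norm_pos_iff.2 hy0) (norm_pos_iff.2 hx0) hyx)
  exact nonlocalPer_congr_kernel (indicator_ae_eq_of_ae_eq_set (this.symm.trans hG)) E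

theorem nonlocalPer_volBall_le (hN : 1 ≤ N) {K : EuclideanSpace ℝ (Fin N) → ℝ≥0}
    (hint : Integrable (fun x => min ‖x‖ 1 * (K x : ℝ)) volume) (hK : RadiallyDecreasing K)
    {E : Set (EuclideanSpace ℝ (Fin N))} (hE : NullMeasurableSet E) (hEf : volume E ≠ ∞) :
    nonlocalPer (fun x => (K x : ℝ≥0∞)) (volBall 0 (volume E)) ≤
      nonlocalPer (fun x => (K x : ℝ≥0∞)) E := by
  rw [← nonlocalPer_symmDecrRearr_eq hN hint hK]
  exact nonlocalPer_symmDecrRearr_le hN hint hE hEf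

end Perimeter

/-! ### Reflections and polarization -/

section Reflection
variable {V : Type*} [NormedAddCommGroup V] [InnerProductSpace ℝ V]

/-- The reflection in the hyperplane `⟪u, x⟫ = c`, for a unit vector `u`. -/
def hyperplaneReflection (u : V) (c : ℝ) (x : V) : V := x - (2 * (inner ℝ u x - c)) • u

theorem inner_hyperplaneReflection {u : V} (hu : ‖u‖ = 1) (c : ℝ) (x : V) :
    inner ℝ u (hyperplaneReflection u c x) - c = -(inner ℝ u x - c) := by
  rw [hyperplaneReflection, inner_sub_right, inner_smul_right, real_inner_self_eq_norm_sq, hu]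
  ring

theorem hyperplaneReflection_involutive {u : V} (hu : ‖u‖ = 1) (c : ℝ) :
    Function.Involutive (hyperplaneReflection u c) := fun x => by
  rw [hyperplaneReflection, inner_hyperplaneReflection hu, hyperplaneReflection]
  module

theorem hyperplaneReflection_eq_self {u : V} {c : ℝ} {x : V} (h : inner ℝ u x - c = 0) :
    hyperplaneReflection u c x = x := by
  simp [hyperplaneReflection, h]

theorem hyperplaneReflection_neg (u : V) (c : ℝ) :
    hyperplaneReflection (-u) (-c) = hyperplaneReflection u c := by
  ext x
  rw [hyperplaneReflection, hyperplaneReflection, inner_neg_left]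
  module

theorem norm_sub_hyperplaneReflection_sq {u : V} (hu : ‖u‖ = 1) (c : ℝ) (x y : V) :
    ‖x - hyperplaneReflection u c y‖ ^ 2 =
      ‖x - y‖ ^ 2 + 4 * ((inner ℝ u x - c) * (inner ℝ u y - c)) := by
  have : x - hyperplaneReflection u c y = (x - y) + (2 * (inner ℝ u y - c)) • u := by
    rw [hyperplaneReflection]; module
  rw [this, norm_add_sq_real, inner_smul_right, norm_smul, hu, real_inner_comm u (x - y),
    inner_sub_right,
    mul_one, Real.norm_eq_abs, sq_abs]
  ring

theorem norm_hyperplaneReflection_sq {u : V} (hu : ‖u‖ = 1) (c : ℝ) (x : V) :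
    ‖hyperplaneReflection u c x‖ ^ 2 = ‖x‖ ^ 2 - 4 * c * (inner ℝ u x - c) := by
  have := norm_sub_hyperplaneReflection_sq hu c 0 x
  rw [zero_sub, norm_neg, zero_sub, norm_neg, inner_zero_right] at this
  rw [this]; ring

theorem dist_hyperplaneReflection_comm {u : V} (hu : ‖u‖ = 1) (c : ℝ) (x y : V) :
    dist (hyperplaneReflection u c x) y = dist x (hyperplaneReflection u c y) := by
  rw [dist_comm, dist_eq_norm, dist_eq_norm, ← sq_eq_sq₀ (norm_nonneg _) (norm_nonneg _),
    norm_sub_hyperplaneReflection_sq hu, norm_sub_hyperplaneReflection_sq hu, norm_sub_rev]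
  ring

theorem dist_hyperplaneReflection {u : V} (hu : ‖u‖ = 1) (c : ℝ) (x y : V) :
    dist (hyperplaneReflection u c x) (hyperplaneReflection u c y) = dist x y := by
  rw [dist_hyperplaneReflection_comm hu, hyperplaneReflection_involutive hu]

theorem dist_le_dist_hyperplaneReflection {u : V} (hu : ‖u‖ = 1) {c : ℝ} {x y : V}
    (h : 0 ≤ (inner ℝ u x - c) * (inner ℝ u y - c)) :
    dist x y ≤ dist x (hyperplaneReflection u c y) := by
  rw [dist_eq_norm, dist_eq_norm, ← sq_le_sq₀ (norm_nonneg _) (norm_nonneg _),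
    norm_sub_hyperplaneReflection_sq hu]
  linarith

theorem dist_hyperplaneReflection_le_dist {u : V} (hu : ‖u‖ = 1) {c : ℝ} {x y : V}
    (h : (inner ℝ u x - c) * (inner ℝ u y - c) ≤ 0) :
    dist x (hyperplaneReflection u c y) ≤ dist x y := by
  rw [dist_eq_norm, dist_eq_norm, ← sq_le_sq₀ (norm_nonneg _) (norm_nonneg _),
    norm_sub_hyperplaneReflection_sq hu]
  linarith

theorem dist_lt_dist_hyperplaneReflection {u : V} (hu : ‖u‖ = 1) {c : ℝ} {x y : V}
    (h : 0 < (inner ℝ u x - c) * (inner ℝ u y - c)) :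
    dist x y < dist x (hyperplaneReflection u c y) := by
  rw [dist_eq_norm, dist_eq_norm, ← sq_lt_sq₀ (norm_nonneg _) (norm_nonneg _),
    norm_sub_hyperplaneReflection_sq hu]
  linarith

theorem measurePreserving_hyperplaneReflection [FiniteDimensional ℝ V] [MeasurableSpace V]
    [BorelSpace V] {u : V} (hu : ‖u‖ = 1) (c : ℝ) :
    MeasurePreserving (hyperplaneReflection u c) := by
  have h := (measurePreserving_add_right (volume : Measure V) ((2 * c) • u)).comp
    (Submodule.reflection (Submodule.span ℝ {u})ᗮ).measurePreserving
  have heq : hyperplaneReflection u c =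
      (fun x => x + (2 * c) • u) ∘ (Submodule.reflection (Submodule.span ℝ {u})ᗮ) := by
    ext x
    rw [Function.comp_apply, Submodule.reflection_orthogonal_apply,
      Submodule.reflection_singleton_apply, hu, hyperplaneReflection]
    simp
    module
  rwa [heq]

/-- The polarization (two-point rearrangement) of `E` with respect to the hyperplane
`⟪u, x⟫ = c`: of each pair of points exchanged by the reflection, if exactly one belongs to `E`,
then the one with `⟪u, x⟫ < c` is selected. The points of the hyperplane itself are fixed by the
reflection and stay as they are. -/
def polarize (u : V) (c : ℝ) (E : Set V) : Set V :=
  {x | (inner ℝ u x - c ≤ 0 ∧ (x ∈ E ∨ hyperplaneReflection u c x ∈ E)) ∨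
    (0 < inner ℝ u x - c ∧ x ∈ E ∧ hyperplaneReflection u c x ∈ E)}

/-- Membership in the polarization for a pair of mirror points, in terms of the point nearer to the
side selected. -/
theorem polarize_near {u : V} (hu : ‖u‖ = 1) {c : ℝ} (E : Set V) {x : V}
    (h : inner ℝ u x - c ≤ 0) :
    (x ∈ polarize u c E ↔ x ∈ E ∨ hyperplaneReflection u c x ∈ E) ∧
    (hyperplaneReflection u c x ∈ polarize u c E ↔ x ∈ E ∧ hyperplaneReflection u c x ∈ E) := by
  simp only [polarize, mem_ofPred_eq, inner_hyperplaneReflection hu,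
    hyperplaneReflection_involutive hu c x]
  rcases h.eq_or_lt with h | h
  · simp [h, hyperplaneReflection_eq_self h]
  · have h1 : ¬ 0 < inner ℝ u x - c := h.not_gt
    have h2 : ¬ -(inner ℝ u x - c) ≤ 0 := by linarith
    have h3 : 0 < -(inner ℝ u x - c) := by linarith
    have h4 := h.le
    tauto

theorem polarize_far {u : V} (hu : ‖u‖ = 1) {c : ℝ} (E : Set V) {x : V}
    (h : 0 ≤ inner ℝ u x - c) :
    (x ∈ polarize u c E ↔ x ∈ E ∧ hyperplaneReflection u c x ∈ E) ∧
    (hyperplaneReflection u c x ∈ polarize u c E ↔ x ∈ E ∨ hyperplaneReflection u c x ∈ E) := by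
  have := polarize_near hu (c := c) E (x := hyperplaneReflection u c x)
    (by rw [inner_hyperplaneReflection hu]; linarith)
  rw [hyperplaneReflection_involutive hu c x] at this
  exact ⟨this.2.trans and_comm, this.1.trans or_comm⟩

theorem measurable_hyperplaneReflection [MeasurableSpace V]
    [BorelSpace V] [SecondCountableTopology V] (u : V) (c : ℝ) :
    Measurable (hyperplaneReflection u c) := by
  unfold hyperplaneReflection
  fun_prop

theorem measurableSet_polarize [MeasurableSpace V] [BorelSpace V] [SecondCountableTopology V]
    (u : V) (c : ℝ) {E : Set V} (hE : MeasurableSet E) : MeasurableSet (polarize u c E) := by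
  have hσ := measurable_hyperplaneReflection u c hE
  have hi : Measurable fun x : V => inner ℝ u x - c := by fun_prop
  exact ((measurableSet_le hi measurable_const).inter (hE.union hσ)).union
    ((measurableSet_lt measurable_const hi).inter (hE.inter hσ))

theorem volume_polarize [FiniteDimensional ℝ V] [MeasurableSpace V] [BorelSpace V] {u : V}
    (hu : ‖u‖ = 1) (c : ℝ) {E : Set V} (hE : MeasurableSet E) :
    volume (polarize u c E) = volume E := by
  have key : ∀ D : Set V, MeasurableSet D →
      ∫⁻ x, (D.indicator 1 x + D.indicator 1 (hyperplaneReflection u c x)) = 2 * volume D :=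
    fun D hD => by
      rw [lintegral_add_left (measurable_one.indicator hD),
        (measurePreserving_hyperplaneReflection hu c).lintegral_comp (measurable_one.indicator hD),
        lintegral_indicator_one hD, two_mul]
  have h2 : 2 * volume (polarize u c E) = 2 * volume E := by
    rw [← key _ hE, ← key _ (measurableSet_polarize u c hE)]
    refine lintegral_congr fun x => ?_
    rcases le_total (inner ℝ u x - c) 0 with h | h
    · by_cases h1 : x ∈ E <;> by_cases h2 : hyperplaneReflection u c x ∈ E <;>
        simp [indicator, (polarize_near hu E h).1, (polarize_near hu E h).2, h1, h2]
    · by_cases h1 : x ∈ E <;> by_cases h2 : hyperplaneReflection u c x ∈ E <;>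
        simp [indicator, (polarize_far hu E h).1, (polarize_far hu E h).2, h1, h2]
  exact (ENNReal.mul_right_inj (by simp) (by simp)).1 h2

end Reflection

section PairEnergy
variable {V : Type*} [NormedAddCommGroup V] [InnerProductSpace ℝ V]

open Classical in
/-- The interaction `φ(|x - y|)` counted for `x ∈ E`, `y ∉ E`. -/
noncomputable def crossInteraction (φ : ℝ → ℝ≥0∞) (E : Set V) (p : V × V) : ℝ≥0∞ :=
  if p.1 ∈ E ∧ p.2 ∉ E then φ (dist p.1 p.2) else 0

theorem measurable_crossInteraction {V : Type*} [NormedAddCommGroup V] [MeasurableSpace V]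
    [BorelSpace V]
    [SecondCountableTopology V] {φ : ℝ → ℝ≥0∞} (hφ : Antitone φ)
    {E : Set V} (hE : MeasurableSet E) : Measurable (crossInteraction φ E) :=
  Measurable.ite ((measurable_fst hE).inter (measurable_snd hE).compl)
    (hφ.measurable.comp (measurable_fst.dist measurable_snd)) measurable_const

/-- The sum of the interaction over the four pairs obtained from `(x, y)` by reflecting each of the
two points. -/
noncomputable def symmInteraction (φ : ℝ → ℝ≥0∞) (u : V) (c : ℝ) (E : Set V) (p : V × V) :
    ℝ≥0∞ :=
  crossInteraction φ E p + crossInteraction φ E (hyperplaneReflection u c p.1, p.2) +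
    (crossInteraction φ E (p.1, hyperplaneReflection u c p.2) +
      crossInteraction φ E (hyperplaneReflection u c p.1, hyperplaneReflection u c p.2))

open Classical in
theorem symmInteraction_eq {u : V} (hu : ‖u‖ = 1) (φ : ℝ → ℝ≥0∞) (c : ℝ) (E : Set V) (x y : V) :
    symmInteraction φ u c E (x, y) =
      (if x ∈ E ∧ y ∉ E then φ (dist x y) else 0) +
      (if hyperplaneReflection u c x ∈ E ∧ y ∉ E then
        φ (dist x (hyperplaneReflection u c y)) else 0) +
      ((if x ∈ E ∧ hyperplaneReflection u c y ∉ E then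
        φ (dist x (hyperplaneReflection u c y)) else 0) +
      (if hyperplaneReflection u c x ∈ E ∧ hyperplaneReflection u c y ∉ E then
        φ (dist x y) else 0)) := by
  simp only [symmInteraction, crossInteraction, dist_hyperplaneReflection_comm hu,
    hyperplaneReflection_involutive hu c y]

/-- The two-point inequality: `φ` is decreasing, and two points on the same side of the hyperplane
are closer to each other than either is to the reflection of the other. -/
theorem symmInteraction_polarize_le {u : V} (hu : ‖u‖ = 1) {φ : ℝ → ℝ≥0∞} (hφ : Antitone φ)
    (c : ℝ) (E : Set V) (p : V × V) :
    symmInteraction φ u c (polarize u c E) p ≤ symmInteraction φ u c E p := by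
  obtain ⟨x, y⟩ := p
  rw [symmInteraction_eq hu, symmInteraction_eq hu]
  rcases le_total (inner ℝ u x - c) 0 with hx | hx <;>
    rcases le_total (inner ℝ u y - c) 0 with hy | hy
  · have hd := hφ (dist_le_dist_hyperplaneReflection hu (mul_nonneg_of_nonpos_of_nonpos hx hy))
    rw [(polarize_near hu E hx).1, (polarize_near hu E hx).2, (polarize_near hu E hy).1,
      (polarize_near hu E hy).2]
    by_cases h1 : x ∈ E <;> by_cases h2 : hyperplaneReflection u c x ∈ E <;>
      by_cases h3 : y ∈ E <;> by_cases h4 : hyperplaneReflection u c y ∈ E <;>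
      simp [h1, h2, h3, h4, hd, add_comm]
  · have hd := hφ (dist_hyperplaneReflection_le_dist hu (mul_nonpos_of_nonpos_of_nonneg hx hy))
    rw [(polarize_near hu E hx).1, (polarize_near hu E hx).2, (polarize_far hu E hy).1,
      (polarize_far hu E hy).2]
    by_cases h1 : x ∈ E <;> by_cases h2 : hyperplaneReflection u c x ∈ E <;>
      by_cases h3 : y ∈ E <;> by_cases h4 : hyperplaneReflection u c y ∈ E <;>
      simp [h1, h2, h3, h4, hd, add_comm]
  · have hd := hφ (dist_hyperplaneReflection_le_dist hu (mul_nonpos_of_nonneg_of_nonpos hx hy))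
    rw [(polarize_far hu E hx).1, (polarize_far hu E hx).2, (polarize_near hu E hy).1,
      (polarize_near hu E hy).2]
    by_cases h1 : x ∈ E <;> by_cases h2 : hyperplaneReflection u c x ∈ E <;>
      by_cases h3 : y ∈ E <;> by_cases h4 : hyperplaneReflection u c y ∈ E <;>
      simp [h1, h2, h3, h4, hd, add_comm]
  · have hd := hφ (dist_le_dist_hyperplaneReflection hu (mul_nonneg hx hy))
    rw [(polarize_far hu E hx).1, (polarize_far hu E hx).2, (polarize_far hu E hy).1,
      (polarize_far hu E hy).2]
    by_cases h1 : x ∈ E <;> by_cases h2 : hyperplaneReflection u c x ∈ E <;>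
      by_cases h3 : y ∈ E <;> by_cases h4 : hyperplaneReflection u c y ∈ E <;>
      simp [h1, h2, h3, h4, hd, add_comm]

/-- The two-point inequality is strict when polarization moves exactly one of the two pairs. -/
theorem symmInteraction_polarize_lt {u : V} (hu : ‖u‖ = 1) {φ : ℝ → ℝ≥0∞}
    (hφ : StrictAntiOn φ (Ici 0)) {c : ℝ} {E : Set V} {x y : V}
    (hx : inner ℝ u x - c < 0) (hxE : x ∈ E) (hxE' : hyperplaneReflection u c x ∉ E)
    (hy : inner ℝ u y - c < 0) (hyE : y ∉ E) (hyE' : hyperplaneReflection u c y ∈ E) :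
    symmInteraction φ u c (polarize u c E) (x, y) < symmInteraction φ u c E (x, y) := by
  have hd := hφ dist_nonneg dist_nonneg (dist_lt_dist_hyperplaneReflection hu
    (mul_pos_of_neg_of_neg hx hy))
  rw [symmInteraction_eq hu, symmInteraction_eq hu, (polarize_near hu E hx.le).1,
    (polarize_near hu E hx.le).2, (polarize_near hu E hy.le).1, (polarize_near hu E hy.le).2]
  simpa [hxE, hxE', hyE, hyE'] using hd

variable [FiniteDimensional ℝ V] [MeasurableSpace V] [BorelSpace V]

theorem measurable_symmInteraction {φ : ℝ → ℝ≥0∞} (hφ : Antitone φ) (u : V) (c : ℝ)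
    {E : Set V} (hE : MeasurableSet E) : Measurable (symmInteraction φ u c E) := by
  have h := measurable_crossInteraction hφ hE
  have hσ := measurable_hyperplaneReflection u c
  unfold symmInteraction
  fun_prop

theorem lintegral_symmInteraction {u : V} (hu : ‖u‖ = 1) {φ : ℝ → ℝ≥0∞} (hφ : Antitone φ) (c : ℝ)
    {E : Set V} (hE : MeasurableSet E) :
    ∫⁻ p, symmInteraction φ u c E p = 4 * ∫⁻ p, crossInteraction φ E p := by
  have h := measurable_crossInteraction hφ hE
  have hσ := measurePreserving_hyperplaneReflection hu c
  have hid := MeasurePreserving.id (volume : Measure V)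
  have h1 := (hσ.prod hid).lintegral_comp h
  have h2 := (hid.prod hσ).lintegral_comp h
  have h3 := (hσ.prod hσ).lintegral_comp h
  simp only [Prod.map, id, ← Measure.volume_eq_prod] at h1 h2 h3
  have hm := hσ.measurable
  unfold symmInteraction
  rw [lintegral_add_left (by fun_prop), lintegral_add_left h, lintegral_add_left (by fun_prop),
    h1, h2, h3]
  ring

/-- Polarization strictly decreases the interaction if there are, in positive measure, both points
of `E` that it keeps on the side `⟪u, x⟫ < c` and points of `E` that it moves to that side. -/
theorem lintegral_crossInteraction_polarize_lt {u : V} (hu : ‖u‖ = 1) {φ : ℝ → ℝ≥0∞}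
    (hφ : Antitone φ) (hφs : StrictAntiOn φ (Ici 0)) {c : ℝ} {E : Set V} (hE : MeasurableSet E)
    (hfin : ∫⁻ p, crossInteraction φ E p ≠ ∞)
    (hP : volume {x | inner ℝ u x - c < 0 ∧ x ∈ E ∧ hyperplaneReflection u c x ∉ E} ≠ 0)
    (hQ : volume {x | inner ℝ u x - c < 0 ∧ x ∉ E ∧ hyperplaneReflection u c x ∈ E} ≠ 0) :
    ∫⁻ p, crossInteraction φ (polarize u c E) p < ∫⁻ p, crossInteraction φ E p := by
  have hle := symmInteraction_polarize_le hu hφ c E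
  have h4 : (4 : ℝ≥0∞) * ∫⁻ p, crossInteraction φ (polarize u c E) p <
      4 * ∫⁻ p, crossInteraction φ E p := by
    rw [← lintegral_symmInteraction hu hφ c hE,
      ← lintegral_symmInteraction hu hφ c (measurableSet_polarize u c hE)]
    refine lintegral_strict_mono_of_ae_le_of_ae_lt_on
      (measurable_symmInteraction hφ u c hE).aemeasurable ?_ (Filter.Eventually.of_forall hle)
      (s := {x | inner ℝ u x - c < 0 ∧ x ∈ E ∧ hyperplaneReflection u c x ∉ E} ×ˢ
        {x | inner ℝ u x - c < 0 ∧ x ∉ E ∧ hyperplaneReflection u c x ∈ E}) ?_ ?_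
    · refine ne_top_of_le_ne_top ?_ (lintegral_mono hle)
      rw [lintegral_symmInteraction hu hφ c hE]
      exact ENNReal.mul_ne_top (by simp) hfin
    · rw [Measure.volume_eq_prod, Measure.prod_prod]
      exact mul_ne_zero hP hQ
    · refine Filter.Eventually.of_forall ?_
      rintro ⟨x, y⟩ ⟨⟨hx, hxE, hxE'⟩, ⟨hy, hyE, hyE'⟩⟩
      exact symmInteraction_polarize_lt hu hφs hx hxE hxE' hy hyE hyE'
  exact (ENNReal.mul_lt_mul_iff_right (by simp) (by simp)).1 h4

end PairEnergy

/-! ### Finite perimeter of balls, translations, bisection and density -/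

section Finite
variable {N : ℕ}

/-- The perimeter as an integral over the difference `z = x - y`. -/
theorem nonlocalPer_eq_lintegral_mul {k : EuclideanSpace ℝ (Fin N) → ℝ≥0∞} (hk : Measurable k)
    {E : Set (EuclideanSpace ℝ (Fin N))} (hE : MeasurableSet E) :
    nonlocalPer k E = ∫⁻ z, k z * volume {x | x ∈ E ∧ x - z ∉ E} := by
  have hS : MeasurableSet {p : EuclideanSpace ℝ (Fin N) × EuclideanSpace ℝ (Fin N) |
      p.1 ∈ E ∧ p.1 - p.2 ∉ E} :=
    (measurable_fst hE).inter ((measurable_fst.sub measurable_snd) hE).compl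
  have h1 : nonlocalPer k E = ∫⁻ x, ∫⁻ z, {p : EuclideanSpace ℝ (Fin N) ×
      EuclideanSpace ℝ (Fin N) | p.1 ∈ E ∧ p.1 - p.2 ∉ E}.indicator (fun p => k p.2) (x, z) := by
    rw [nonlocalPer, ← lintegral_indicator hE]
    refine lintegral_congr fun x => ?_
    by_cases hx : x ∈ E
    · rw [indicator_of_mem hx, ← lintegral_indicator hE.compl,
        ← lintegral_sub_left_eq_self _ x]
      refine lintegral_congr fun z => ?_
      by_cases hz : x - z ∈ E <;> simp [indicator, hx, hz]
    · simp [indicator, hx]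
  rw [h1, lintegral_lintegral_swap]
  · refine lintegral_congr fun z => ?_
    have hz : MeasurableSet {x | x ∈ E ∧ x - z ∉ E} := measurable_prodMk_right hS
    rw [← lintegral_indicator_const hz]
    rfl
  · exact ((hk.comp measurable_snd).indicator hS).aemeasurable

/-- The part of a ball which a translation by `z` uncovers has volume
`O(min |z| 1)`. -/
theorem volume_ball_sdiff_translate_le (hN : 1 ≤ N) {r : ℝ} (hr : 0 < r) :
    ∃ C : ℝ≥0∞, C ≠ ∞ ∧ ∀ z : EuclideanSpace ℝ (Fin N),
      volume {x | x ∈ Metric.ball 0 r ∧ x - z ∉ Metric.ball 0 r} ≤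
        C * ENNReal.ofReal (min ‖z‖ 1) := by
  have : Nontrivial (EuclideanSpace ℝ (Fin N)) := by
    have : Nonempty (Fin N) := ⟨⟨0, hN⟩⟩
    infer_instance
  set ω := volume (Metric.ball (0 : EuclideanSpace ℝ (Fin N)) 1) with hω
  have hω1 : ω ≠ ∞ := measure_ball_lt_top.ne
  have hvol : ∀ s : ℝ, 0 ≤ s → volume (Metric.ball (0 : EuclideanSpace ℝ (Fin N)) s) =
      ENNReal.ofReal (s ^ N) * ω := fun s hs => by
    rw [Measure.addHaar_ball _ _ hs, finrank_euclideanSpace, Fintype.card_fin]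
  have hN' : (1 : ℝ) ≤ N := by exact_mod_cast hN
  refine ⟨ENNReal.ofReal (r ^ N * (N / r + 1)) * ω, ENNReal.mul_ne_top ENNReal.ofReal_ne_top hω1,
    fun z => ?_⟩
  rw [mul_right_comm, ← ENNReal.ofReal_mul (by positivity)]
  have hrN : 0 < r ^ N := by positivity
  have hNr : 0 < N / r := by positivity
  by_cases hz : ‖z‖ ≤ min 1 r
  · have hz1 := hz.trans (min_le_left _ _)
    have hzr := hz.trans (min_le_right _ _)
    calc _ ≤ volume (Metric.ball (0 : EuclideanSpace ℝ (Fin N)) r \ Metric.ball 0 (r - ‖z‖)) := by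
          refine measure_mono fun x hx => ⟨hx.1, fun h => hx.2 ?_⟩
          rw [mem_ball_zero_iff] at h ⊢
          exact (norm_sub_le _ _).trans_lt (by linarith)
      _ = ENNReal.ofReal (r ^ N - (r - ‖z‖) ^ N) * ω := by
          rw [measure_sdiff (Metric.ball_subset_ball (by linarith [norm_nonneg z]))
            measurableSet_ball.nullMeasurableSet measure_ball_lt_top.ne, hvol r hr.le,
            hvol _ (by linarith), ENNReal.ofReal_sub _ (pow_nonneg (by linarith) _),
            ENNReal.sub_mul fun _ _ => hω1]
      _ ≤ _ := by
          gcongr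
          rw [min_eq_left hz1]
          -- Bernoulli's inequality
          have hb := one_add_mul_le_pow (a := -(‖z‖ / r)) (by
            have := (div_le_one hr).2 hzr
            linarith) N
          have he : (r - ‖z‖) ^ N = r ^ N * (1 + -(‖z‖ / r)) ^ N := by
            rw [← mul_pow]; congr 1; field_simp; ring
          have hm := mul_le_mul_of_nonneg_left hb hrN.le
          rw [← he] at hm
          have e : r ^ N * (N / r + 1) * ‖z‖ =
              r ^ N - r ^ N * (1 + N * -(‖z‖ / r)) + r ^ N * ‖z‖ := by
            field_simp; ring
          rw [e]
          have := mul_nonneg hrN.le (norm_nonneg z)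
          linarith
  · calc _ ≤ volume (Metric.ball (0 : EuclideanSpace ℝ (Fin N)) r) :=
          measure_mono fun x hx => hx.1
      _ = ENNReal.ofReal (r ^ N) * ω := hvol r hr.le
      _ ≤ _ := by
          gcongr
          have h1 : 1 ≤ (N / r + 1) * min ‖z‖ 1 := by
            rcases le_total ‖z‖ 1 with h | h
            · rw [min_eq_left h]
              have hrz : r ≤ ‖z‖ := by
                by_contra! hc
                exact hz (le_min h hc.le)
              have : 1 ≤ N / r * ‖z‖ := by
                rw [div_mul_eq_mul_div, le_div_iff₀ hr]
                nlinarith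
              nlinarith [norm_nonneg z]
            · rw [min_eq_right h]; linarith
          rw [mul_assoc]
          exact le_mul_of_one_le_right hrN.le h1

theorem nonlocalPer_ball_ne_top (hN : 1 ≤ N) {K : EuclideanSpace ℝ (Fin N) → ℝ≥0}
    (hint : Integrable (fun x => min ‖x‖ 1 * (K x : ℝ)) volume) {r : ℝ} (hr : 0 < r) :
    nonlocalPer (fun x => (K x : ℝ≥0∞)) (Metric.ball 0 r) ≠ ∞ := by
  obtain ⟨k, hk, hKk⟩ := aemeasurable_kernel hN hint
  obtain ⟨C, hC, hle⟩ := volume_ball_sdiff_translate_le hN hr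
  rw [nonlocalPer_congr_kernel hKk, nonlocalPer_eq_lintegral_mul hk measurableSet_ball]
  have hfin : ∫⁻ z, ENNReal.ofReal (min ‖z‖ 1 * (K z : ℝ)) ≠ ∞ := by
    rw [← ofReal_integral_eq_lintegral_ofReal hint
      (Filter.Eventually.of_forall fun z => by positivity)]
    exact ENNReal.ofReal_ne_top
  refine ne_top_of_le_ne_top (ENNReal.mul_ne_top hC hfin) ?_
  rw [← lintegral_const_mul' _ _ hC]
  refine lintegral_mono_ae (hKk.mono fun z hz => ?_)
  rw [← hz, ENNReal.ofReal_mul (by positivity), ENNReal.ofReal_coe_nnreal]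
  calc _ ≤ (K z : ℝ≥0∞) * (C * ENNReal.ofReal (min ‖z‖ 1)) := by gcongr; exact hle z
    _ = _ := by ring

theorem nonlocalPer_preimage_add (k : EuclideanSpace ℝ (Fin N) → ℝ≥0∞)
    (E : Set (EuclideanSpace ℝ (Fin N))) (c : EuclideanSpace ℝ (Fin N)) :
    nonlocalPer k ((fun x => x + c) ⁻¹' E) = nonlocalPer k E := by
  have hp := measurePreserving_add_right (volume : Measure (EuclideanSpace ℝ (Fin N))) c
  have he := measurableEmbedding_addRight c
  rw [nonlocalPer, nonlocalPer,
    ← hp.setLIntegral_comp_preimage_emb he (fun x => ∫⁻ y in Eᶜ, k (x - y)) E]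
  refine lintegral_congr fun x => ?_
  rw [← hp.setLIntegral_comp_preimage_emb he (fun y => k (x + c - y)) Eᶜ, preimage_compl]
  simp

theorem volBall_eq_preimage (x : EuclideanSpace ℝ (Fin N)) (m : ℝ≥0∞) :
    volBall x m = (fun y => y + -x) ⁻¹' volBall 0 m := by
  ext y
  simp [volBall, dist_eq_norm, sub_eq_add_neg]

/-- A strictly decreasing profile, extended by `∞` to `(-∞, 0]`, computes the perimeter as an
integral over pairs of points. -/
theorem RadiallyStrictlyDecreasing.exists_profile {K : EuclideanSpace ℝ (Fin N) → ℝ≥0}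
    (hK : RadiallyStrictlyDecreasing K) :
    ∃ φ : ℝ → ℝ≥0∞, Antitone φ ∧ StrictAntiOn φ (Ici 0) ∧
      ∀ E : Set (EuclideanSpace ℝ (Fin N)), MeasurableSet E →
        nonlocalPer (fun x => (K x : ℝ≥0∞)) E = ∫⁻ p, crossInteraction φ E p := by
  obtain ⟨φ, hφ, hKφ⟩ := hK
  have hstrict : StrictAntiOn (fun t => if 0 < t then (φ t : ℝ≥0∞) else ∞) (Ici 0) := by
    intro s hs t _ hst
    have ht : 0 < t := lt_of_le_of_lt hs hst
    by_cases hs0 : 0 < s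
    · simpa [hs0, ht] using hφ hs0 ht hst
    · simp [hs0, ht]
  have hanti : Antitone (fun t => if 0 < t then (φ t : ℝ≥0∞) else ∞) := by
    intro s t hst
    by_cases hs : 0 < s
    · exact hstrict.antitoneOn hs.le (hs.trans_le hst).le hst
    · simp [hs]
  refine ⟨_, hanti, hstrict, fun E hE => ?_⟩
  rw [Measure.volume_eq_prod, lintegral_prod _ (measurable_crossInteraction hanti hE).aemeasurable,
    nonlocalPer, ← lintegral_indicator hE]
  refine lintegral_congr fun x => ?_
  by_cases hx : x ∈ E
  · rw [indicator_of_mem hx, ← lintegral_indicator hE.compl]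
    refine lintegral_congr fun y => ?_
    by_cases hy : y ∈ E
    · simp [crossInteraction, hy]
    · have hxy : x - y ≠ 0 := fun h => hy (sub_eq_zero.1 h ▸ hx)
      have hd : 0 < ‖x - y‖ := norm_pos_iff.2 hxy
      rw [indicator_of_mem (by exact hy), crossInteraction, if_pos ⟨hx, hy⟩, hKφ _ hxy,
        dist_eq_norm, if_pos hd]
  · simp [crossInteraction, hx]

end Finite

section Hyperplane
variable {V : Type*} [NormedAddCommGroup V] [InnerProductSpace ℝ V] [FiniteDimensional ℝ V]
  [MeasurableSpace V] [BorelSpace V]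

theorem volume_hyperplane {u : V} (hu : ‖u‖ = 1) (c : ℝ) :
    volume {x : V | inner ℝ u x = c} = 0 := by
  have h0 : volume (((Submodule.span ℝ {u})ᗮ : Submodule ℝ V) : Set V) = 0 := by
    refine Measure.addHaar_submodule _ _ fun h => ?_
    have hm : u ∈ (Submodule.span ℝ {u})ᗮ := h ▸ Submodule.mem_top
    rw [Submodule.mem_orthogonal_singleton_iff_inner_right, real_inner_self_eq_norm_sq, hu] at hm
    norm_num at hm
  rw [← measure_preimage_add_right volume (-(c • u))] at h0
  refine measure_mono_null (fun x hx => ?_) h0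
  rw [mem_preimage, SetLike.mem_coe, Submodule.mem_orthogonal_singleton_iff_inner_right,
    inner_add_right, inner_neg_right, inner_smul_right, real_inner_self_eq_norm_sq, hu, hx]
  ring

/-- Every set of finite volume is bisected by a hyperplane in any given direction. -/
theorem exists_bisecting_hyperplane {u : V} (hu : ‖u‖ = 1) {E : Set V} (hEf : volume E ≠ ∞) :
    ∃ c : ℝ, volume {x | x ∈ E ∧ inner ℝ u x < c} = volume {x | x ∈ E ∧ c < inner ℝ u x} := by
  rcases eq_or_ne (volume E) 0 with h0 | h0
  · exact ⟨0, by
      rw [measure_mono_null (fun x hx => hx.1) h0, measure_mono_null (fun x hx => hx.1) h0]⟩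
  have hm : Measurable fun x : V => inner ℝ u x := by fun_prop
  have : IsFiniteMeasure (volume.restrict E) := isFiniteMeasure_restrict.2 hEf
  set μ := (volume.restrict E).map fun x : V => inner ℝ u x with hμ
  have : NullSingletonClass μ := ⟨fun c => by
    rw [hμ, Measure.map_apply hm (measurableSet_singleton c)]
    exact nonpos_iff_eq_zero.1 ((Measure.restrict_apply_le _ _).trans (volume_hyperplane hu c).le)⟩
  have huniv : μ univ = volume E := by
    rw [hμ, Measure.map_apply hm MeasurableSet.univ]; simp
  obtain ⟨c, hc⟩ := exists_measure_Iic_eq μ (t := volume E / 2)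
    (ENNReal.half_pos h0) (by rw [huniv]; exact ENNReal.half_lt_self h0 hEf)
  have hc' : μ (Ioi c) = volume E / 2 := by
    rw [← compl_Iic, measure_compl measurableSet_Iic (measure_ne_top _ _), huniv, hc,
      ENNReal.sub_half hEf]
  rw [← measure_congr (Iio_ae_eq_Iic (μ := μ) (a := c))] at hc
  rw [hμ, Measure.map_apply hm measurableSet_Iio,
    Measure.restrict_apply (hm measurableSet_Iio)] at hc
  rw [hμ, Measure.map_apply hm measurableSet_Ioi,
    Measure.restrict_apply (hm measurableSet_Ioi)] at hc'
  refine ⟨c, ?_⟩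
  rw [inter_comm] at hc hc'
  exact hc.trans hc'.symm

/-- Two sets of positive measure contain parts that are carried into each other by the reflection
exchanging suitable points of density. -/
theorem exists_hyperplaneReflection_inter {P Q : Set V} (hP : MeasurableSet P)
    (hQ : MeasurableSet Q) (hP0 : volume P ≠ 0) (hQ0 : volume Q ≠ 0) (hPQ : Disjoint P Q) :
    ∃ p ∈ P, ∃ q ∈ Q, volume {x | x ∈ P ∧ hyperplaneReflection (‖q - p‖⁻¹ • (q - p))
      ((‖q‖ ^ 2 - ‖p‖ ^ 2) / (2 * ‖q - p‖)) x ∈ Q} ≠ 0 := by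
  have hdens : ∀ S : Set V, MeasurableSet S → volume S ≠ 0 → ∃ x ∈ S, ∀ᶠ r in nhdsWithin 0 (Ioi 0),
      volume (Metric.closedBall x r) / 2 < volume (S ∩ Metric.closedBall x r) := by
    intro S hS hS0
    obtain ⟨x, hxS, hx⟩ := ((frequently_ae_mem_iff.2 hS0).and_eventually
      (Besicovitch.ae_tendsto_measure_inter_div_of_measurableSet volume hS)).exists
    rw [indicator_of_mem hxS, Pi.one_apply] at hx
    refine ⟨x, hxS, ?_⟩
    filter_upwards [(tendsto_order.1 hx).1 _ ENNReal.one_half_lt_one, self_mem_nhdsWithin]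
      with r hr hr0
    have := (ENNReal.lt_div_iff_mul_lt (Or.inl (Metric.measure_closedBall_pos volume x hr0).ne')
      (Or.inl measure_closedBall_lt_top.ne)).1 hr
    rwa [mul_comm, ← div_eq_mul_inv] at this
  obtain ⟨p, hpP, hp⟩ := hdens P hP hP0
  obtain ⟨q, hqQ, hq⟩ := hdens Q hQ hQ0
  refine ⟨p, hpP, q, hqQ, fun hnull => ?_⟩
  obtain ⟨r, hrp, hrq⟩ := (hp.and hq).exists
  have hpq : q - p ≠ 0 := fun h => (disjoint_left.1 hPQ hpP) (sub_eq_zero.1 h ▸ hqQ)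
  have hn : ‖q - p‖ ≠ 0 := norm_ne_zero_iff.2 hpq
  set u := ‖q - p‖⁻¹ • (q - p) with hu'
  set c := (‖q‖ ^ 2 - ‖p‖ ^ 2) / (2 * ‖q - p‖) with hc
  have hu : ‖u‖ = 1 := by rw [hu', norm_smul, norm_inv, norm_norm, inv_mul_cancel₀ hn]
  have hσp : hyperplaneReflection u c p = q := by
    have h1 : 2 * (inner ℝ u p - c) = -‖q - p‖ := by
      have h2 := norm_sub_sq_real q p
      rw [hu', hc, inner_smul_left, inner_sub_left, real_inner_self_eq_norm_sq]
      simp only [conj_trivial]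
      field_simp
      linarith
    rw [hyperplaneReflection, h1, hu', smul_smul, neg_mul, mul_inv_cancel₀ hn]
    module
  have hσ := measurePreserving_hyperplaneReflection hu c
  have hball : hyperplaneReflection u c ⁻¹' Metric.closedBall q r = Metric.closedBall p r := by
    ext x
    rw [mem_preimage, Metric.mem_closedBall, Metric.mem_closedBall, ← hσp,
      dist_hyperplaneReflection hu]
  have hvol : volume (Metric.closedBall q r) = volume (Metric.closedBall p r) := by
    rw [← hball, hσ.measure_preimage measurableSet_closedBall.nullMeasurableSet]
  rw [← hσ.measure_preimage (hQ.inter measurableSet_closedBall).nullMeasurableSet, preimage_inter,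
    hball, hvol] at hrq
  have hdis : volume ((P ∩ Metric.closedBall p r) ∩
      (hyperplaneReflection u c ⁻¹' Q ∩ Metric.closedBall p r)) = 0 :=
    measure_mono_null (fun x hx => show _ ∧ _ from ⟨hx.1.1, hx.2.1⟩) hnull
  -- both sets occupy more than half of the ball about `p`, so they cannot be almost disjoint
  have hlt := ENNReal.add_lt_add hrp hrq
  rw [ENNReal.add_halves, ← measure_union_add_inter _
    ((hσ.measurable hQ).inter measurableSet_closedBall), hdis, add_zero] at hlt
  exact absurd (measure_mono (union_subset inter_subset_right inter_subset_right)) (not_le.2 hlt)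

end Hyperplane

/-! ### Minimizers of the perimeter -/

section Minimizers
variable {N : ℕ}

/-- If a minimizer `E` of the perimeter at fixed volume has at least as much mass on the side
`⟪u, x⟫ < c` of a hyperplane as on the other one, then polarization leaves it unchanged. -/
theorem volume_notMem_hyperplaneReflection_mem_eq_zero {K : EuclideanSpace ℝ (Fin N) → ℝ≥0}
    (hK : RadiallyStrictlyDecreasing K) {E : Set (EuclideanSpace ℝ (Fin N))}
    (hE : MeasurableSet E) (hEf : volume E ≠ ∞)
    (hfin : nonlocalPer (fun x => (K x : ℝ≥0∞)) E ≠ ∞)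
    (hmin : ∀ E', MeasurableSet E' → volume E' = volume E →
      nonlocalPer (fun x => (K x : ℝ≥0∞)) E ≤ nonlocalPer (fun x => (K x : ℝ≥0∞)) E')
    {u : EuclideanSpace ℝ (Fin N)} (hu : ‖u‖ = 1) {c : ℝ}
    (hc : volume {x | x ∈ E ∧ c < inner ℝ u x} ≤ volume {x | x ∈ E ∧ inner ℝ u x < c}) :
    volume {x | inner ℝ u x - c < 0 ∧ x ∉ E ∧ hyperplaneReflection u c x ∈ E} = 0 := by
  obtain ⟨φ, hφ, hφs, hper⟩ := hK.exists_profile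
  have hσ := measurePreserving_hyperplaneReflection hu c
  have hm : Measurable fun x : EuclideanSpace ℝ (Fin N) => inner ℝ u x := by fun_prop
  set B := {x | inner ℝ u x - c < 0 ∧ x ∈ E ∧ hyperplaneReflection u c x ∈ E}
  have hnear : volume {x | inner ℝ u x - c < 0 ∧ x ∈ E ∧ hyperplaneReflection u c x ∉ E} +
      volume B = volume {x | x ∈ E ∧ inner ℝ u x < c} := by
    rw [← measure_sdiff_add_inter {x | x ∈ E ∧ inner ℝ u x < c} (hσ.measurable hE)]
    refine congrArg₂ (· + ·) (congrArg _ ?_) (congrArg _ ?_) <;> ext x <;>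
      simp [B, sub_neg] <;> tauto
  have hfar : volume {x | inner ℝ u x - c < 0 ∧ x ∉ E ∧ hyperplaneReflection u c x ∈ E} +
      volume B = volume {x | x ∈ E ∧ c < inner ℝ u x} := by
    have hfarm : MeasurableSet {x | x ∈ E ∧ c < inner ℝ u x} :=
      hE.inter (measurableSet_lt measurable_const hm)
    rw [← hσ.measure_preimage hfarm.nullMeasurableSet, ← measure_sdiff_add_inter
      (hyperplaneReflection u c ⁻¹' {x | x ∈ E ∧ c < inner ℝ u x}) hE]
    have hi : ∀ x, c < inner ℝ u (hyperplaneReflection u c x) ↔ inner ℝ u x < c := fun x => by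
      have := inner_hyperplaneReflection hu c x
      constructor <;> intro h <;> linarith
    refine congrArg₂ (· + ·) (congrArg _ ?_) (congrArg _ ?_) <;> ext x <;>
      simp [B, sub_neg, hi] <;> tauto
  have hBf : volume B ≠ ∞ := ne_top_of_le_ne_top hEf (measure_mono fun x hx => hx.2.1)
  rw [← hnear, ← hfar] at hc
  have hQP := (ENNReal.add_le_add_iff_right hBf).1 hc
  by_contra hQ
  have hP : volume {x | inner ℝ u x - c < 0 ∧ x ∈ E ∧ hyperplaneReflection u c x ∉ E} ≠ 0 :=
    fun h => hQ (nonpos_iff_eq_zero.1 (hQP.trans h.le))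
  have hpol := measurableSet_polarize u c hE
  have hlt := lintegral_crossInteraction_polarize_lt hu hφ hφs hE (by rwa [← hper E hE]) hP hQ
  rw [← hper _ hpol, ← hper E hE] at hlt
  exact absurd (hmin _ hpol (volume_polarize hu c hE)) (not_le.2 hlt)

/-- A minimizer is symmetric in every hyperplane that bisects it: polarization towards either side
leaves it unchanged. -/
theorem ae_eq_preimage_hyperplaneReflection {K : EuclideanSpace ℝ (Fin N) → ℝ≥0}
    (hK : RadiallyStrictlyDecreasing K) {E : Set (EuclideanSpace ℝ (Fin N))}
    (hE : MeasurableSet E) (hEf : volume E ≠ ∞)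
    (hfin : nonlocalPer (fun x => (K x : ℝ≥0∞)) E ≠ ∞)
    (hmin : ∀ E', MeasurableSet E' → volume E' = volume E →
      nonlocalPer (fun x => (K x : ℝ≥0∞)) E ≤ nonlocalPer (fun x => (K x : ℝ≥0∞)) E')
    {u : EuclideanSpace ℝ (Fin N)} (hu : ‖u‖ = 1) {c : ℝ}
    (hc : volume {x | x ∈ E ∧ inner ℝ u x < c} = volume {x | x ∈ E ∧ c < inner ℝ u x}) :
    hyperplaneReflection u c ⁻¹' E =ᵐ[volume] E := by
  have hσ := measurePreserving_hyperplaneReflection hu c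
  have h1 := volume_notMem_hyperplaneReflection_mem_eq_zero hK hE hEf hfin hmin hu hc.ge
  have h2 := volume_notMem_hyperplaneReflection_mem_eq_zero hK hE hEf hfin hmin
    (u := -u) (c := -c) (by rwa [norm_neg]) (by
      simp only [inner_neg_left, neg_lt_neg_iff]
      exact hc.le)
  rw [hyperplaneReflection_neg] at h2
  refine ae_eq_of_ae_subset_of_measure_ge ?_ (hσ.measure_preimage hE.nullMeasurableSet).ge
    (hσ.measurable hE).nullMeasurableSet hEf
  rw [ae_le_set]
  refine measure_mono_null (fun x hx => ?_) (measure_union_null h1 h2)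
  rcases lt_trichotomy (inner ℝ u x - c) 0 with h | h | h
  · exact Or.inl ⟨h, hx.2, hx.1⟩
  · exact absurd (hyperplaneReflection_eq_self h ▸ hx.1 : x ∈ E) hx.2
  · refine Or.inr ⟨?_, hx.2, hx.1⟩
    rw [inner_neg_left]; linarith

/-- A set that is invariant under the reflections in all coordinate hyperplanes is symmetric about
the origin. -/
theorem ae_eq_preimage_neg_of_coordinate_reflections {E : Set (EuclideanSpace ℝ (Fin N))}
    (h : ∀ i, hyperplaneReflection (EuclideanSpace.single i (1 : ℝ)) 0 ⁻¹' E =ᵐ[volume] E) :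
    (fun x => -x) ⁻¹' E =ᵐ[volume] E := by
  have key : ∀ s : Finset (Fin N), ∃ g : EuclideanSpace ℝ (Fin N) → EuclideanSpace ℝ (Fin N),
      MeasurePreserving g ∧ (∀ x j, g x j = if j ∈ s then -x j else x j) ∧
        g ⁻¹' E =ᵐ[volume] E := by
    intro s
    induction s using Finset.induction_on with
    | empty => exact ⟨id, MeasurePreserving.id _, by simp, Filter.EventuallyEq.rfl⟩
    | insert i s hi ih =>
      obtain ⟨g, hg, hgx, hgE⟩ := ih
      refine ⟨hyperplaneReflection (EuclideanSpace.single i (1 : ℝ)) 0 ∘ g,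
        (measurePreserving_hyperplaneReflection (by simp) 0).comp hg, fun x j => ?_, ?_⟩
      · by_cases hj : j = i
        · subst hj
          simp [hyperplaneReflection, hgx, hi, EuclideanSpace.inner_single_left]
          ring
        · simp [hyperplaneReflection, hgx, hj]
      · rw [preimage_comp]
        exact (hg.quasiMeasurePreserving.preimage_ae_eq (h i)).trans hgE
  obtain ⟨g, -, hgx, hgE⟩ := key Finset.univ
  have : g = fun x => -x := by
    ext x j
    simp [hgx]
  rwa [← this]

/-- A minimizer of the perimeter that is symmetric about the origin is a ball. -/
theorem ae_eq_volBall_of_symmetric_minimizer (hN : 1 ≤ N) {K : EuclideanSpace ℝ (Fin N) → ℝ≥0}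
    (hK : RadiallyStrictlyDecreasing K) {E : Set (EuclideanSpace ℝ (Fin N))}
    (hE : MeasurableSet E) (hEf : volume E ≠ ∞)
    (hfin : nonlocalPer (fun x => (K x : ℝ≥0∞)) E ≠ ∞)
    (hmin : ∀ E', MeasurableSet E' → volume E' = volume E →
      nonlocalPer (fun x => (K x : ℝ≥0∞)) E ≤ nonlocalPer (fun x => (K x : ℝ≥0∞)) E')
    (hneg : (fun x => -x) ⁻¹' E =ᵐ[volume] E) : E =ᵐ[volume] volBall 0 (volume E) := by
  have hW : MeasurableSet (volBall (0 : EuclideanSpace ℝ (Fin N)) (volume E)) := measurableSet_ball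
  have hvol := volume_volBall hN (0 : EuclideanSpace ℝ (Fin N)) hEf
  set W := volBall (0 : EuclideanSpace ℝ (Fin N)) (volume E) with hWdef
  have hsymm : volume (E \ W) = volume (W \ E) := measure_sdiff_symm hE.nullMeasurableSet
    hW.nullMeasurableSet hvol.symm (ne_top_of_le_ne_top hEf (measure_mono inter_subset_left))
  by_cases h0 : volume (E \ W) = 0
  · exact ae_eq_of_ae_subset_of_measure_ge (ae_le_set.2 h0) hvol.le hE.nullMeasurableSet
      (hvol.trans_ne hEf)
  exfalso
  obtain ⟨p, hp, q, hq, hpq⟩ := exists_hyperplaneReflection_inter (hW.diff hE) (hE.diff hW)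
    (by rwa [← hsymm]) h0 (disjoint_left.2 fun x hx hx' => hx.2 hx'.1)
  have hnpq : ‖p‖ < ‖q‖ :=
    (mem_ball_zero_iff.1 hp.1).trans_le (not_lt.1 (mt mem_ball_zero_iff.2 hq.2))
  have hqp : 0 < ‖q - p‖ := norm_pos_iff.2 fun h => by
    rw [sub_eq_zero.1 h] at hnpq; exact lt_irrefl _ hnpq
  have hc : 0 < (‖q‖ ^ 2 - ‖p‖ ^ 2) / (2 * ‖q - p‖) := by
    have : ‖p‖ ^ 2 < ‖q‖ ^ 2 := pow_lt_pow_left₀ hnpq (norm_nonneg _) two_ne_zero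
    exact div_pos (by linarith) (by positivity)
  have hu : ‖‖q - p‖⁻¹ • (q - p)‖ = 1 := by
    rw [norm_smul, norm_inv, norm_norm, inv_mul_cancel₀ hqp.ne']
  generalize (‖q‖ ^ 2 - ‖p‖ ^ 2) / (2 * ‖q - p‖) = c at hc hpq
  generalize ‖q - p‖⁻¹ • (q - p) = u at hu hpq
  have hm : Measurable fun x : EuclideanSpace ℝ (Fin N) => inner ℝ u x := by fun_prop
  refine hpq (measure_mono_null (fun x hx => ?_) (volume_notMem_hyperplaneReflection_mem_eq_zero
    hK hE hEf hfin hmin hu (c := c) ?_))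
  -- the reflection moves `x` away from the origin, so `x` is on the side of the origin
  · refine ⟨?_, hx.1.2, hx.2.1⟩
    have h1 : ‖x‖ < ‖hyperplaneReflection u c x‖ :=
      (mem_ball_zero_iff.1 hx.1.1).trans_le (not_lt.1 (mt mem_ball_zero_iff.2 hx.2.2))
    have h2 := pow_lt_pow_left₀ h1 (norm_nonneg _) two_ne_zero
    rw [norm_hyperplaneReflection_sq hu] at h2
    by_contra! h3
    linarith [mul_nonneg hc.le h3]
  · have hpre : volume {x | x ∈ E ∧ c < inner ℝ u x} = volume {x | x ∈ E ∧ inner ℝ u x < -c} := by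
      have hfarm : MeasurableSet {x | x ∈ E ∧ c < inner ℝ u x} :=
        hE.inter (measurableSet_lt measurable_const hm)
      rw [← (Measure.measurePreserving_neg (volume : Measure (EuclideanSpace ℝ (Fin N)))
        ).measure_preimage hfarm.nullMeasurableSet]
      refine measure_congr ?_
      filter_upwards [hneg] with x hx
      have hx' : -x ∈ E ↔ x ∈ E := iff_of_eq hx
      refine propext ?_
      change (-x ∈ E ∧ c < inner ℝ u (-x)) ↔ (x ∈ E ∧ inner ℝ u x < -c)
      rw [hx', inner_neg_right, lt_neg]
    rw [hpre]
    exact measure_mono fun x hx => ⟨hx.1, hx.2.trans (by linarith)⟩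

/-- Equality case: a minimizer is a translate of the ball. The centre is found by bisecting the set
by a hyperplane orthogonal to each coordinate axis. -/
theorem exists_ae_eq_volBall_of_minimizer (hN : 1 ≤ N) {K : EuclideanSpace ℝ (Fin N) → ℝ≥0}
    (hK : RadiallyStrictlyDecreasing K) {E : Set (EuclideanSpace ℝ (Fin N))}
    (hE : MeasurableSet E) (hEf : volume E ≠ ∞)
    (hfin : nonlocalPer (fun x => (K x : ℝ≥0∞)) E ≠ ∞)
    (hmin : ∀ E', MeasurableSet E' → volume E' = volume E →
      nonlocalPer (fun x => (K x : ℝ≥0∞)) E ≤ nonlocalPer (fun x => (K x : ℝ≥0∞)) E') :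
    ∃ x, E =ᵐ[volume] volBall x (volume E) := by
  have hbis : ∀ i : Fin N, ∃ c : ℝ,
      volume {x | x ∈ E ∧ inner ℝ (EuclideanSpace.single i (1 : ℝ)) x < c} =
        volume {x | x ∈ E ∧ c < inner ℝ (EuclideanSpace.single i (1 : ℝ)) x} :=
    fun i => exists_bisecting_hyperplane (by simp) hEf
  choose c hc using hbis
  set a : EuclideanSpace ℝ (Fin N) := WithLp.toLp 2 c with ha
  have hp := measurePreserving_add_right (volume : Measure (EuclideanSpace ℝ (Fin N))) a
  set E₀ := (fun x => x + a) ⁻¹' E with hE₀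
  have hE₀m : MeasurableSet E₀ := hp.measurable hE
  have hv : volume E₀ = volume E := hp.measure_preimage hE.nullMeasurableSet
  have hper := nonlocalPer_preimage_add (fun x => (K x : ℝ≥0∞)) E a
  rw [← hE₀] at hper
  have hEf₀ : volume E₀ ≠ ∞ := hv.trans_ne hEf
  have hfin₀ : nonlocalPer (fun x => (K x : ℝ≥0∞)) E₀ ≠ ∞ := hper.trans_ne hfin
  have hmin₀ : ∀ E', MeasurableSet E' → volume E' = volume E₀ →
      nonlocalPer (fun x => (K x : ℝ≥0∞)) E₀ ≤ nonlocalPer (fun x => (K x : ℝ≥0∞)) E' :=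
    fun E' h1 h2 => hper.trans_le (hmin E' h1 (h2.trans hv))
  have hcoord : ∀ i, hyperplaneReflection (EuclideanSpace.single i (1 : ℝ)) 0 ⁻¹' E₀
      =ᵐ[volume] E₀ := fun i => by
    refine ae_eq_preimage_hyperplaneReflection hK hE₀m hEf₀ hfin₀ hmin₀ (by simp) ?_
    have hm : Measurable fun x : EuclideanSpace ℝ (Fin N) =>
      inner ℝ (EuclideanSpace.single i (1 : ℝ)) x := by fun_prop
    have hlow : MeasurableSet {x | x ∈ E ∧ inner ℝ (EuclideanSpace.single i (1 : ℝ)) x < c i} :=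
      hE.inter (measurableSet_lt hm measurable_const)
    have hhigh : MeasurableSet {x | x ∈ E ∧ c i < inner ℝ (EuclideanSpace.single i (1 : ℝ)) x} :=
      hE.inter (measurableSet_lt measurable_const hm)
    have hci := hc i
    rw [← hp.measure_preimage hlow.nullMeasurableSet,
      ← hp.measure_preimage hhigh.nullMeasurableSet] at hci
    convert hci using 2
    · ext x
      simp [E₀, ha, EuclideanSpace.inner_single_left]
    · ext x
      simp [E₀, ha, EuclideanSpace.inner_single_left]
  have hball := ae_eq_volBall_of_symmetric_minimizer hN hK hE₀m hEf₀ hfin₀ hmin₀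
    (ae_eq_preimage_neg_of_coordinate_reflections hcoord)
  refine ⟨a, ?_⟩
  have h := (measurePreserving_add_right (volume : Measure (EuclideanSpace ℝ (Fin N)))
    (-a)).quasiMeasurePreserving.preimage_ae_eq hball
  rw [hv, ← volBall_eq_preimage, hE₀, ← preimage_comp] at h
  have hid : (fun x : EuclideanSpace ℝ (Fin N) => x + a) ∘ (fun x => x + -a) = id := by
    ext1 x
    simp
  rwa [hid, preimage_id] at h

theorem nonlocalPer_volBall_ne_top (hN : 1 ≤ N) {K : EuclideanSpace ℝ (Fin N) → ℝ≥0}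
    (hint : Integrable (fun x => min ‖x‖ 1 * (K x : ℝ)) volume) (m : ℝ≥0∞) :
    nonlocalPer (fun x => (K x : ℝ≥0∞)) (volBall 0 m) ≠ ∞ := by
  rw [volBall]
  rcases ENNReal.toReal_nonneg.eq_or_lt with h | h
  · rw [← h, Metric.ball_zero]
    simp [nonlocalPer]
  · exact nonlocalPer_ball_ne_top hN hint h

theorem RadiallyStrictlyDecreasing.radiallyDecreasing {K : EuclideanSpace ℝ (Fin N) → ℝ≥0}
    (hK : RadiallyStrictlyDecreasing K) : RadiallyDecreasing K :=
  let ⟨φ, hφ, h⟩ := hK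
  ⟨φ, hφ.antitoneOn, h⟩

end Minimizers

theorem proposition3p1 (N : ℕ) (hN : 1 ≤ N) (K : EuclideanSpace ℝ (Fin N) → ℝ≥0)
    (hsymm : ∀ x, K x = K (-x))
    (hint : Integrable (fun x => min ‖x‖ 1 * (K x : ℝ)) volume) :
    (∀ E : Set (EuclideanSpace ℝ (Fin N)), NullMeasurableSet E volume → volume E < ∞ →
      nonlocalPer (fun x => (K x : ℝ≥0∞)) E ≥
        nonlocalPer (symmDecrRearr (fun x => (K x : ℝ≥0∞))) (volBall 0 (volume E))) ∧
    (RadiallyDecreasing K →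
      ∀ E : Set (EuclideanSpace ℝ (Fin N)), NullMeasurableSet E volume → volume E < ∞ →
        nonlocalPer (fun x => (K x : ℝ≥0∞)) E ≥
          nonlocalPer (fun x => (K x : ℝ≥0∞)) (volBall 0 (volume E))) ∧
    (RadiallyStrictlyDecreasing K →
      ∀ E : Set (EuclideanSpace ℝ (Fin N)), NullMeasurableSet E volume → volume E < ∞ →
        (nonlocalPer (fun x => (K x : ℝ≥0∞)) E =
            nonlocalPer (fun x => (K x : ℝ≥0∞)) (volBall 0 (volume E)) ↔
          ∃ x : EuclideanSpace ℝ (Fin N), E =ᵐ[volume] volBall x (volume E))) := by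
  refine ⟨fun E hE hEf => nonlocalPer_symmDecrRearr_le hN hint hE hEf.ne,
    fun hK E hE hEf => nonlocalPer_volBall_le hN hint hK hE hEf.ne,
    fun hK E hE hEf => ⟨fun heq => ?_, ?_⟩⟩
  · obtain ⟨E', -, hE', hEE'⟩ := hE.exists_measurable_superset_ae_eq
    have hv := measure_congr hEE'
    have hper := nonlocalPer_congr_set (fun x => (K x : ℝ≥0∞)) hEE'
    obtain ⟨x, hx⟩ := exists_ae_eq_volBall_of_minimizer hN hK hE' (hv.trans_ne hEf.ne)
      (by rw [hper, heq]; exact nonlocalPer_volBall_ne_top hN hint _)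
      fun F hF hFv => by
        rw [hper, heq, ← hv, ← hFv]
        exact nonlocalPer_volBall_le hN hint hK.radiallyDecreasing hF.nullMeasurableSet
          (by rw [hFv, hv]; exact hEf.ne)
    rw [hv] at hx
    exact ⟨x, hEE'.symm.trans hx⟩
  · rintro ⟨x, hx⟩
    rw [nonlocalPer_congr_set _ hx, volBall_eq_preimage, nonlocalPer_preimage_add]
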